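/- Throughout, algebras are associative over a field $F$ and need not be unital; $F$ is algebraically closed of characteristic zero. Let $q$ be a prime number or $q=4$, and let $G$ be a cyclic group of order $q$, written additively and identified with $\mathbb{Z}/q\mathbb{Z}$ by the choice of a generator. Let $C=\bigoplus_{g\in G}C_g$ be a finite-dimensional $G$-graded $F$-algebra ($C_gC_h\subseteq C_{g+h}$) with a graded involution $*$, i.e. an $F$-linear map with $(a^*)^*=a$, $(ab)^*=b^*a^*$ and $C_g^*=C_g$ for all $g\in G$. The algebra $C$ is called *$*$-graded simple* if $C\cdot C\neq 0$ and $C$ has no two-sided ideal $I$ with $0\ne I\ne C$ that is an $F$-subspace, is graded ($I=\bigoplus_g (I\cap C_g)$) and satisfies $I^*\subseteq I$. For a subgroup $H\le G$ let $F[H]$ be the group algebra with basis $\{\eta_\xi\}_{\xi\in H}$, $\eta_\xi\eta_{\zeta}=\eta_{\xi+\zeta}$. A $k$-tuple $(\theta_1,\dots,\theta_k)\in G^k$ ($k\ge 1$) defines a $G$-grading on $M_k(F[H])$ by $\deg(E_{ij}\eta_\xi)=-\theta_i+\xi+\theta_j$, where $E_{ij}$ are the matrix units; for $H=0$ it is the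 *elementary grading* of $M_k(F)$ with $\deg E_{ij}=-\theta_i+\theta_j$, and for $\theta_1=\dots=\theta_k=0$ it is the grading of $M_k(F[H])$ *induced by the natural grading* of $F[H]$. A graded involution on $M_k(F[H])$ with such a grading is *elementary* if for all $i,j,\xi$ there are $i',j',\xi'$ with $(E_{ij}\eta_\xi)^*=\pm E_{i'j'}\eta_{\xi'}$. The *symplectic involution* of $M_{2m}(F)$ is $X\mapsto J^{-1}X^{T}J$ with $J=\begin{pmatrix}0&-I_m\\ I_m&0\end{pmatrix}$. **Theorem.** $C$ is $*$-graded simple if and only if $C$ is isomorphic, as a graded algebra with involution, to one of the following algebras (with $k\ge 1$). 1. $\mathcal{B}\times\mathcal{B}^{op}$ with components $\mathcal{B}_g\times\mathcal{B}^{op}_g$ and the exchange involution $(a,b)\mapsto(b,a)$, where $\mathcal{B}=M_k(F[H])$ is graded by some $k$-tuple in $G^k$, and $H=0$, or $H=G$, or $q=4$ and $H=\{\bar 0,\bar 2\}$. 2. $M_k(F)$ with an elementary grading and an elementary involution. 3. $M_k(F[H])$, $H$ a (necessarily cyclic) subgroup of $G$, with the grading induced by the natural grading of $F[H]$ and the involution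 $\bigl(\sum_{\theta\in H}X_\theta\eta_\theta\bigr)^*=\sum_{\theta\in H}X_\theta^{\mathfrak t}\eta_\theta$, where $X_\theta\in M_k(F)$ and $\mathfrak t$ is the transpose involution or ($k$ even) the symplectic involution of $M_k(F)$. 4. $M_k(F[H])$, $H$ a subgroup of $G$ with $H\cong\mathbb{Z}/2\mathbb{Z}$ or $H\cong\mathbb{Z}/4\mathbb{Z}$, with the grading induced by the natural grading of $F[H]$ and the involution $\bigl(\sum_{\theta\in H}X_\theta\eta_\theta\bigr)^*=\sum_{\theta\in H}(-1)^\theta X_\theta^{\mathfrak t}\eta_\theta$, where $\mathfrak t$ is as in 3 and $(-1)^\theta$ is the parity sign of the image of $\theta$ in $\mathbb{Z}/2\mathbb{Z}$ or $\mathbb{Z}/4\mathbb{Z}$. 5. If $q=4$: $M_k(F[H])$ with $H=\{\bar 0,\bar 2\}$, graded by a $k$-tuple $(\theta_1,\dots,\theta_k)\in\{\bar 0,\bar 1\}^k$, with an elementary involution. -/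

import Mathlib

/-! Gradings, graded involutions and the model algebras. Algebras are associative over a field `F`
and are not assumed to be unital. The grading group `G` is written additively. -/

/-- `𝒜` is a `G`-grading of the algebra `A`: `A = ⨁ g, 𝒜 g` and `𝒜 g * 𝒜 h ⊆ 𝒜 (g + h)`. -/
structure IsAlgGrading {F G A : Type*} [Field F] [AddCommGroup G] [DecidableEq G]
    [NonUnitalRing A] [Module F A] (𝒜 : G → Submodule F A) : Prop where
  isInternal : DirectSum.IsInternal 𝒜
  mul_mem : ∀ g h : G, ∀ a ∈ 𝒜 g, ∀ b ∈ 𝒜 h, a * b ∈ 𝒜 (g + h)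

/-- `σ` is an `F`-linear involution of `A` that preserves each component of the grading `𝒜`. -/
structure IsGradedInvolution {F G A : Type*} [Field F] [NonUnitalRing A] [Module F A]
    (𝒜 : G → Submodule F A) (σ : A →ₗ[F] A) : Prop where
  involutive : ∀ a, σ (σ a) = a
  map_mul : ∀ a b, σ (a * b) = σ b * σ a
  map_mem : ∀ g : G, ∀ a ∈ 𝒜 g, σ a ∈ 𝒜 g

/-- `I` is a graded `*`-ideal: a two-sided ideal with `I = ⨁ g, I ∩ 𝒜 g` and `I^* ⊆ I`. -/
structure IsGradedStarIdeal {F G A : Type*} [Field F] [NonUnitalRing A] [Module F A]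
    (𝒜 : G → Submodule F A) (σ : A →ₗ[F] A) (I : Submodule F A) : Prop where
  mul_mem_left : ∀ a, ∀ x ∈ I, a * x ∈ I
  mul_mem_right : ∀ a, ∀ x ∈ I, x * a ∈ I
  graded : I = ⨆ g, I ⊓ 𝒜 g
  star_mem : ∀ x ∈ I, σ x ∈ I

/-- `A` is `*`-graded simple: its product is not identically zero, and its only graded `*`-ideals
are `0` and `A`. -/
structure IsStarGradedSimple {F G A : Type*} [Field F] [NonUnitalRing A] [Module F A]
    (𝒜 : G → Submodule F A) (σ : A →ₗ[F] A) : Prop where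
  exists_mul_ne_zero : ∃ a b : A, a * b ≠ 0
  eq_bot_or_eq_top : ∀ I : Submodule F A, IsGradedStarIdeal 𝒜 σ I → I = ⊥ ∨ I = ⊤

/-- `(A, 𝒜, σ)` and `(B, ℬ, τ)` are isomorphic as graded `*`-algebras. -/
def GradedStarIsomorphic {F G A B : Type*} [Field F] [NonUnitalRing A] [Module F A]
    [NonUnitalRing B] [Module F B] (𝒜 : G → Submodule F A) (σ : A →ₗ[F] A)
    (ℬ : G → Submodule F B) (τ : B →ₗ[F] B) : Prop :=
  ∃ φ : A ≃ₗ[F] B, (∀ a b, φ (a * b) = φ a * φ b) ∧ (∀ a, φ (σ a) = τ (φ a)) ∧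
    ∀ g : G, (𝒜 g).map (φ : A →ₗ[F] B) = ℬ g

/-! ### The product of an algebra and its opposite -/

/-- The grading of `B × Bᵒᵖ`, with components `ℬ g × ℬ g`. -/
def prodOpGrading {F G B : Type*} [Field F] [NonUnitalRing B] [Module F B]
    (ℬ : G → Submodule F B) : G → Submodule F (B × Bᵐᵒᵖ) :=
  fun g => (ℬ g).prod ((ℬ g).map (MulOpposite.opLinearEquiv F : B ≃ₗ[F] Bᵐᵒᵖ).toLinearMap)

/-- The exchange involution `(a, b) ↦ (b, a)` of `B × Bᵒᵖ`. -/
def exchangeInvolution (F B : Type*) [Field F] [NonUnitalRing B] [Module F B] :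
    (B × Bᵐᵒᵖ) →ₗ[F] (B × Bᵐᵒᵖ) where
  toFun x := (x.2.unop, MulOpposite.op x.1)
  map_add' _ _ := rfl
  map_smul' _ _ := rfl

/-! ### Matrices over `F` -/

/-- The elementary grading of `M_ι(F)` given by the tuple `t`: `deg E_ij = -t_i + t_j`. -/
def elementaryGrading (F : Type*) {G ι : Type*} [Field F] [AddCommGroup G] [DecidableEq ι]
    (t : ι → G) : G → Submodule F (Matrix ι ι F) :=
  fun g => Submodule.span F {x | ∃ i j, -t i + t j = g ∧ x = Matrix.single i j 1}

/-- Each `E_ij` goes to some `± E_i'j'`. -/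
def IsElementaryOnMatrix {F ι : Type*} [Field F] [DecidableEq ι]
    (σ : Matrix ι ι F →ₗ[F] Matrix ι ι F) : Prop :=
  ∀ i j, ∃ (i' j' : ι) (α : F), (α = 1 ∨ α = -1) ∧
    σ (Matrix.single i j 1) = α • Matrix.single i' j' 1

/-- The symplectic involution `X ↦ J⁻¹ Xᵀ J` of `M_{2m}(F)`, where `J` is the standard
skew-symmetric matrix; the `2m` indices are `Fin m ⊕ Fin m`. -/
noncomputable def symplecticInvolution (F : Type*) [Field F] (m : ℕ)
    (X : Matrix (Fin m ⊕ Fin m) (Fin m ⊕ Fin m) F) :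
    Matrix (Fin m ⊕ Fin m) (Fin m ⊕ Fin m) F :=
  (Matrix.J (Fin m) F)⁻¹ * X.transpose * Matrix.J (Fin m) F

/-! ### Matrices over the group algebra `F[H]` of a subgroup `H` of `G` -/

/-- The matrix `X η_ξ` of `M_ι(F[H])`, for `X` in `M_ι(F)` and `ξ` in `H`. -/
noncomputable def homogMatrix {F G ι : Type*} [Field F] [AddCommGroup G] {H : AddSubgroup G}
    (X : Matrix ι ι F) (ξ : H) : Matrix ι ι (AddMonoidAlgebra F H) :=
  X.map (AddMonoidAlgebra.single ξ)

/-- The grading of `M_ι(F[H])` given by the tuple `t`: `deg (E_ij η_ξ) = -t_i + ξ + t_j`. For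
`t = 0` it is the grading induced by the natural grading of `F[H]`: `deg (X η_ξ) = ξ`. -/
noncomputable def groupMatrixGrading (F : Type*) {G ι : Type*} [Field F] [AddCommGroup G]
    [DecidableEq ι] (H : AddSubgroup G) (t : ι → G) :
    G → Submodule F (Matrix ι ι (AddMonoidAlgebra F H)) :=
  fun g => Submodule.span F {x | ∃ (i j : ι) (ξ : H), -t i + (ξ : G) + t j = g ∧
    x = homogMatrix (Matrix.single i j 1) ξ}

/-- Each `E_ij η_ξ` goes to some `± E_i'j' η_ξ'`. -/
def IsElementaryOnGroupMatrix {F G ι : Type*} [Field F] [AddCommGroup G] [DecidableEq ι]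
    {H : AddSubgroup G} (σ : Matrix ι ι (AddMonoidAlgebra F H) →ₗ[F]
      Matrix ι ι (AddMonoidAlgebra F H)) : Prop :=
  ∀ (i j : ι) (ξ : H), ∃ (i' j' : ι) (ξ' : H) (α : F), (α = 1 ∨ α = -1) ∧
    σ (homogMatrix (Matrix.single i j 1) ξ) = α • homogMatrix (Matrix.single i' j' 1) ξ'

/-- `σ` is the linear map `∑ X_ξ η_ξ ↦ ∑ χ(ξ) τ(X_ξ) η_ξ` of `M_ι(F[H])`. -/
def IsInducedBy {F G ι : Type*} [Field F] [AddCommGroup G] {H : AddSubgroup G}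
    (σ : Matrix ι ι (AddMonoidAlgebra F H) →ₗ[F] Matrix ι ι (AddMonoidAlgebra F H))
    (τ : Matrix ι ι F → Matrix ι ι F) (χ : H → F) : Prop :=
  ∀ (X : Matrix ι ι F) (ξ : H), σ (homogMatrix X ξ) = χ ξ • homogMatrix (τ X) ξ

/-! Write * for the involution `s`. Simplicity forces graded semiprimeness: a homogeneous a with aCa
= 0 vanishes (`IsStarGradedSimple.eq_zero_of_mul_mul_self`). By finite dimension there is a
primitive idempotent e of degree 0 (`IsStarGradedSimple.exists_isGradedPrimitive`). Its corner eCe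
is a graded division algebra, with components of dimension at most one because F is algebraically
closed. The support H of the corner is cyclic, so no cocycle survives and eCe ≅ F[H]
(`IsGradedPrimitive.exists_isCornerBasis`). Homogeneous dual bases v of Ce and w of eC over the
corner give matrix units v_i u_ξ w_j, which make CeC a copy of M_k(F[H]) (`unitsMap`).

The involution enters through e*Ce. If e*Ce = 0, then CeC and its image under * annihilate each
other and sum to C, which is the exchange algebra (`IsDualSystem.gradedStarIsomorphic_prodOp`).
Otherwise a nonzero homogeneous p in e*Ce is an isomorphism between e and e*, so C = CeC, and x*y
is, up to the factor p, a corner-valued form on Ce. It is hermitian up to a sign ε, relative to u_ξ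
↦ χ(ξ) u_ξ for a character χ with values ±1 (`IsGradedPrimitive.exists_isStarLink`). A homogeneous
Gram–Schmidt process splits Ce into anisotropic vectors and hyperbolic pairs
(`IsStarLink.exists_complete_frame`). In the matrix units of such a frame, * permutes the E_ij η_ξ
up to sign (`IsStarSystem.star_unit`), so it is elementary.

What is left is the list of possible H. For H = 0 this is an elementary involution of M_k(F), and
for H of order two in a group of order four it is item 5. For H = G all data can be shifted into
degree 0, where the form is an ordinary bilinear form over F. If it is symmetric it has an
orthonormal basis and gives the transpose; if it is skew it has only hyperbolic pairs and gives the
symplectic involution (`IsStarLink.exists_induced`). The character χ is trivial or the parity sign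
(`sign_character_eq`).

Conversely, a nonzero homogeneous matrix over F[H] has an entry r η_ξ with r ≠ 0. This is a unit, so
the matrix generates the whole algebra as an ideal (`eq_top_of_homogeneous_mem`). -/

set_option linter.unusedSectionVars false
set_option linter.unusedSimpArgs false

/-! ### Homogeneous components -/

namespace IsAlgGrading

variable {F G C : Type*} [Field F] [AddCommGroup G] [DecidableEq G]
  [NonUnitalRing C] [Module F C] {𝒞 : G → Submodule F C}

/-- The projection onto the component of degree `g`. -/
noncomputable def proj (h : IsAlgGrading 𝒞) (g : G) : C →ₗ[F] C :=
  (𝒞 g).subtype ∘ₗ DirectSum.component F G (fun i => 𝒞 i) g ∘ₗ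
    (LinearEquiv.ofBijective (DirectSum.coeLinearMap 𝒞) h.isInternal).symm.toLinearMap

theorem proj_mem (h : IsAlgGrading 𝒞) (g : G) (x : C) : h.proj g x ∈ 𝒞 g := by
  simp [proj]

theorem equiv_symm_of_mem (h : IsAlgGrading 𝒞) {g : G} {x : C} (hx : x ∈ 𝒞 g) :
    (LinearEquiv.ofBijective (DirectSum.coeLinearMap 𝒞) h.isInternal).symm x =
      DirectSum.lof F G (fun i => 𝒞 i) g ⟨x, hx⟩ := by
  rw [LinearEquiv.symm_apply_eq]
  exact (DirectSum.coeLinearMap_lof 𝒞 g ⟨x, hx⟩).symm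

theorem proj_of_mem (h : IsAlgGrading 𝒞) {g : G} {x : C} (hx : x ∈ 𝒞 g) : h.proj g x = x := by
  simp [proj, h.equiv_symm_of_mem hx, DirectSum.component.lof_self]

theorem proj_of_mem_ne (h : IsAlgGrading 𝒞) {g k : G} {x : C} (hx : x ∈ 𝒞 k) (hk : k ≠ g) :
    h.proj g x = 0 := by
  have := DirectSum.of_eq_of_ne (β := fun i => 𝒞 i) k g ⟨x, hx⟩ hk.symm
  simp only [proj, LinearMap.comp_apply, LinearEquiv.coe_coe, h.equiv_symm_of_mem hx,
    DirectSum.lof_eq_of, ← DirectSum.apply_eq_component, Submodule.coe_subtype] at this ⊢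
  rw [this, Submodule.coe_zero]

theorem sum_proj [Fintype G] (h : IsAlgGrading 𝒞) (x : C) : ∑ g, h.proj g x = x := by
  have hx : x ∈ ⨆ g, 𝒞 g := by
    rw [DirectSum.IsInternal.submodule_iSup_eq_top h.isInternal]; trivial
  induction hx using Submodule.iSup_induction' with
  | mem g x hx =>
    rw [Finset.sum_eq_single g, h.proj_of_mem hx]
    · intro k _ hk
      exact h.proj_of_mem_ne hx hk.symm
    · simp
  | zero => simp
  | add x y _ _ hx hy => simp [Finset.sum_add_distrib, hx, hy]

theorem eq_zero_of_proj [Fintype G] (h : IsAlgGrading 𝒞) {x : C} (hx : ∀ g, h.proj g x = 0) :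
    x = 0 := by
  rw [← h.sum_proj x]; simp [hx]

theorem exists_proj_ne_zero [Fintype G] (h : IsAlgGrading 𝒞) {x : C} (hx : x ≠ 0) :
    ∃ g, h.proj g x ≠ 0 := by
  by_contra! H
  exact hx (h.eq_zero_of_proj H)

theorem proj_mul_left [Fintype G] (h : IsAlgGrading 𝒞) {k : G} {a : C} (ha : a ∈ 𝒞 k) (g : G)
    (x : C) : h.proj (k + g) (a * x) = a * h.proj g x := by
  conv_lhs => rw [← h.sum_proj x]
  rw [Finset.mul_sum, map_sum, Finset.sum_eq_single g,
    h.proj_of_mem (h.mul_mem _ _ _ ha _ (h.proj_mem g x))]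
  · intro l _ hl
    exact h.proj_of_mem_ne (h.mul_mem _ _ _ ha _ (h.proj_mem l x)) (by simpa using hl)
  · simp

theorem proj_mul_right [Fintype G] (h : IsAlgGrading 𝒞) {k : G} {a : C} (ha : a ∈ 𝒞 k) (g : G)
    (x : C) : h.proj (g + k) (x * a) = h.proj g x * a := by
  conv_lhs => rw [← h.sum_proj x]
  rw [Finset.sum_mul, map_sum, Finset.sum_eq_single g,
    h.proj_of_mem (h.mul_mem _ _ _ (h.proj_mem g x) _ ha)]
  · intro l _ hl
    exact h.proj_of_mem_ne (h.mul_mem _ _ _ (h.proj_mem l x) _ ha) (by simpa using hl)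
  · simp

/-- A product with a given homogeneous value is attained on a homogeneous factor. -/
theorem exists_homogeneous_mul_eq [Fintype G] (h : IsAlgGrading 𝒞) {k l : G} {a b y : C}
    (ha : a ∈ 𝒞 k) (hb : b ∈ 𝒞 l) (hy : y * a = b) : ∃ z ∈ 𝒞 (l - k), z * a = b :=
  ⟨h.proj (l - k) y, h.proj_mem _ _, by
    rw [← h.proj_mul_right ha, hy, sub_add_cancel, h.proj_of_mem hb]⟩

theorem eq_iSup_inf_of_proj_mem [Fintype G] (h : IsAlgGrading 𝒞) {I : Submodule F C}
    (hI : ∀ g, ∀ x ∈ I, h.proj g x ∈ I) : I = ⨆ g, I ⊓ 𝒞 g := by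
  apply le_antisymm
  · intro x hx
    rw [← h.sum_proj x]
    exact Submodule.sum_mem _ fun g _ =>
      Submodule.mem_iSup_of_mem g ⟨hI g x hx, h.proj_mem g x⟩
  · exact iSup_le fun g => inf_le_left

theorem proj_mem_span [Fintype G] (h : IsAlgGrading 𝒞) {S : Set C}
    (hS : ∀ g, ∀ x ∈ S, h.proj g x ∈ Submodule.span F S) (g : G) {x : C}
    (hx : x ∈ Submodule.span F S) : h.proj g x ∈ Submodule.span F S := by
  induction hx using Submodule.span_induction with
  | mem x hx => exact hS g x hx
  | zero => simp
  | add x y _ _ hx hy => rw [map_add]; exact add_mem hx hy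
  | smul c x _ hx => rw [map_smul]; exact Submodule.smul_mem _ _ hx

end IsAlgGrading

/-! ### Semiprimeness -/

section Semiprime

variable {F G C : Type*} [Field F] [AddCommGroup G] [DecidableEq G] [Fintype G]
  [NonUnitalRing C] [Module F C] [IsScalarTower F C C] [SMulCommClass F C C]
  {𝒞 : G → Submodule F C} {s : C →ₗ[F] C}

theorem Submodule.mul_mem_of_span_left {S : Set C} {I : Submodule F C} {c : C}
    (h : ∀ x ∈ S, x * c ∈ I) {x : C} (hx : x ∈ Submodule.span F S) : x * c ∈ I := by
  induction hx using Submodule.span_induction with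
  | mem x hx => exact h x hx
  | zero => simp
  | add x y _ _ hx hy => rw [add_mul]; exact add_mem hx hy
  | smul a x _ hx => rw [smul_mul_assoc]; exact Submodule.smul_mem _ _ hx

theorem Submodule.mul_mem_of_span_right {S : Set C} {I : Submodule F C} {c : C}
    (h : ∀ x ∈ S, c * x ∈ I) {x : C} (hx : x ∈ Submodule.span F S) : c * x ∈ I := by
  induction hx using Submodule.span_induction with
  | mem x hx => exact h x hx
  | zero => simp
  | add x y _ _ hx hy => rw [mul_add]; exact add_mem hx hy
  | smul a x _ hx => rw [mul_smul_comm]; exact Submodule.smul_mem _ _ hx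

theorem LinearMap.map_mem_of_span {S : Set C} {I : Submodule F C} {f : C →ₗ[F] C}
    (h : ∀ x ∈ S, f x ∈ I) {x : C} (hx : x ∈ Submodule.span F S) : f x ∈ I :=
  (Submodule.span_le (p := I.comap f)).2 h hx

/-- The two-sided ideal `C a C`. -/
def sandwich (F : Type*) {C : Type*} [Field F] [NonUnitalRing C] [Module F C] (a : C) :
    Submodule F C :=
  Submodule.span F {x | ∃ b c, x = b * a * c}

theorem mul_mul_mem_sandwich (a b c : C) : b * a * c ∈ sandwich F a :=
  Submodule.subset_span ⟨b, c, rfl⟩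

theorem mul_mem_sandwich_left {a x : C} (hx : x ∈ sandwich F a) (y : C) :
    y * x ∈ sandwich F a := by
  refine Submodule.mul_mem_of_span_right ?_ hx
  rintro _ ⟨b, c, rfl⟩
  rw [← mul_assoc, ← mul_assoc]
  exact mul_mul_mem_sandwich _ _ _

theorem mul_mem_sandwich_right {a x : C} (hx : x ∈ sandwich F a) (y : C) :
    x * y ∈ sandwich F a := by
  refine Submodule.mul_mem_of_span_left ?_ hx
  rintro _ ⟨b, c, rfl⟩
  rw [mul_assoc]
  exact mul_mul_mem_sandwich _ _ _

theorem star_mem_sandwich (hs : IsGradedInvolution 𝒞 s) {a x : C} (hx : x ∈ sandwich F a) :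
    s x ∈ sandwich F (s a) := by
  refine LinearMap.map_mem_of_span ?_ hx
  rintro _ ⟨b, c, rfl⟩
  rw [hs.map_mul, hs.map_mul, ← mul_assoc]
  exact mul_mul_mem_sandwich _ _ _

theorem proj_mem_sandwich (h : IsAlgGrading 𝒞) {k : G} {a x : C} (ha : a ∈ 𝒞 k)
    (hx : x ∈ sandwich F a) (g : G) : h.proj g x ∈ sandwich F a := by
  refine h.proj_mem_span ?_ g hx
  rintro g _ ⟨b, c, rfl⟩
  rw [← h.sum_proj b, ← h.sum_proj c, Finset.sum_mul, Finset.sum_mul_sum, map_sum]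
  refine Submodule.sum_mem _ fun i _ => ?_
  rw [map_sum]
  refine Submodule.sum_mem _ fun j _ => ?_
  have hm := h.mul_mem _ _ _ (h.mul_mem _ _ _ (h.proj_mem i b) _ ha) _ (h.proj_mem j c)
  by_cases hg : i + k + j = g
  · subst hg
    rw [h.proj_of_mem hm]
    exact mul_mul_mem_sandwich _ _ _
  · rw [h.proj_of_mem_ne hm hg]
    exact zero_mem _

/-- The graded `*`-ideal `C a C + C a^* C`. -/
theorem isGradedStarIdeal_sandwich_sup (h : IsAlgGrading 𝒞) (hs : IsGradedInvolution 𝒞 s) {k : G}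
    {a : C} (ha : a ∈ 𝒞 k) :
    IsGradedStarIdeal 𝒞 s (sandwich F a ⊔ sandwich F (s a)) where
  mul_mem_left c x hx := by
    obtain ⟨y, hy, z, hz, rfl⟩ := Submodule.mem_sup.1 hx
    rw [mul_add]
    exact Submodule.add_mem_sup (mul_mem_sandwich_left hy c) (mul_mem_sandwich_left hz c)
  mul_mem_right c x hx := by
    obtain ⟨y, hy, z, hz, rfl⟩ := Submodule.mem_sup.1 hx
    rw [add_mul]
    exact Submodule.add_mem_sup (mul_mem_sandwich_right hy c) (mul_mem_sandwich_right hz c)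
  graded := h.eq_iSup_inf_of_proj_mem fun g x hx => by
    obtain ⟨y, hy, z, hz, rfl⟩ := Submodule.mem_sup.1 hx
    rw [map_add]
    exact Submodule.add_mem_sup (proj_mem_sandwich h ha hy g)
      (proj_mem_sandwich h (hs.map_mem _ _ ha) hz g)
  star_mem x hx := by
    obtain ⟨y, hy, z, hz, rfl⟩ := Submodule.mem_sup.1 hx
    rw [map_add, add_comm]
    refine Submodule.add_mem_sup ?_ (star_mem_sandwich hs hy)
    have := star_mem_sandwich hs hz
    rwa [hs.involutive] at this

/-- The span of all products is a nonzero graded *-ideal, hence equals C. If all triple products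
vanished, then CC = (CC)C would be zero. -/
theorem IsStarGradedSimple.exists_triple_mul_ne_zero (hC : IsStarGradedSimple 𝒞 s)
    (h : IsAlgGrading 𝒞) (hs : IsGradedInvolution 𝒞 s) : ∃ x y z : C, x * y * z ≠ 0 := by
  by_contra! H
  obtain ⟨a, b, hab⟩ := hC.exists_mul_ne_zero
  have hI : IsGradedStarIdeal 𝒞 s (Submodule.span F {x : C | ∃ b c, x = b * c}) :=
    { mul_mem_left := fun c x _ => Submodule.subset_span ⟨c, x, rfl⟩
      mul_mem_right := fun c x _ => Submodule.subset_span ⟨x, c, rfl⟩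
      graded := h.eq_iSup_inf_of_proj_mem fun g x hx => by
        refine h.proj_mem_span ?_ g hx
        rintro g _ ⟨b, c, rfl⟩
        rw [← h.sum_proj b, Finset.sum_mul, map_sum]
        refine Submodule.sum_mem _ fun i _ => Submodule.subset_span ⟨h.proj i b, h.proj (g - i) c, ?_⟩
        rw [← h.proj_mul_left (h.proj_mem i b), add_sub_cancel]
      star_mem := fun x hx => by
        refine LinearMap.map_mem_of_span ?_ hx
        rintro _ ⟨b, c, rfl⟩
        exact Submodule.subset_span ⟨s c, s b, hs.map_mul _ _⟩ }
  rcases hC.eq_bot_or_eq_top _ hI with hb | ht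
  · exact hab ((Submodule.mem_bot F).1 (hb ▸ Submodule.subset_span ⟨a, b, rfl⟩))
  · have ha : a ∈ Submodule.span F {x : C | ∃ b c, x = b * c} := ht ▸ Submodule.mem_top
    refine hab ((Submodule.mem_bot F).1 (Submodule.mul_mem_of_span_left ?_ ha))
    rintro _ ⟨x, y, rfl⟩
    exact (Submodule.mem_bot F).2 (H x y b)

theorem sandwich_mul_sandwich {a b x y : C} (hab : ∀ c, a * c * b = 0) (hx : x ∈ sandwich F a)
    (hy : y ∈ sandwich F b) : x * y = 0 := by
  refine (Submodule.mem_bot F).1 (Submodule.mul_mem_of_span_left ?_ hx)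
  rintro _ ⟨p, q, rfl⟩
  refine Submodule.mul_mem_of_span_right ?_ hy
  rintro _ ⟨r, t, rfl⟩
  have : p * a * q * (r * b * t) = p * (a * (q * r) * b) * t := by simp only [mul_assoc]
  rw [this, hab]
  simp

/-- A homogeneous `a` with `a C a = 0` vanishes. -/
theorem IsStarGradedSimple.eq_zero_of_mul_mul_self (hC : IsStarGradedSimple 𝒞 s)
    (h : IsAlgGrading 𝒞) (hs : IsGradedInvolution 𝒞 s) {k : G} {a : C} (ha : a ∈ 𝒞 k)
    (h0 : ∀ c, a * c * a = 0) : a = 0 := by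
  obtain ⟨x, y, z, hxyz⟩ := hC.exists_triple_mul_ne_zero h hs
  have h1 : ∀ c, s a * c * s a = 0 := fun c => by
    have := congrArg s (h0 (s c))
    simpa [hs.map_mul, hs.involutive, mul_assoc] using this
  -- The ideals CaC and Ca*C both have square zero. In each of the eight terms of a triple product
  -- from their sum, two factors lie in the same ideal, so the sum has cube zero and cannot be C.
  have hbot : sandwich F a ⊔ sandwich F (s a) = ⊥ := by
    refine (hC.eq_bot_or_eq_top _ (isGradedStarIdeal_sandwich_sup h hs ha)).resolve_right
      fun ht => hxyz ?_
    have hm : ∀ w : C, ∃ p ∈ sandwich F a, ∃ q ∈ sandwich F (s a), p + q = w := fun w =>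
      Submodule.mem_sup.1 (ht ▸ Submodule.mem_top)
    obtain ⟨x1, hx1, x2, hx2, rfl⟩ := hm x
    obtain ⟨y1, hy1, y2, hy2, rfl⟩ := hm y
    obtain ⟨z1, hz1, z2, hz2, rfl⟩ := hm z
    have e1 := sandwich_mul_sandwich h0 hx1 hy1
    have e2 := sandwich_mul_sandwich h1 hx2 hy2
    have e3 := sandwich_mul_sandwich h0 (mul_mem_sandwich_left hy1 x2) hz1
    have e4 := sandwich_mul_sandwich h1 (mul_mem_sandwich_left hy2 x1) hz2
    have e5 := sandwich_mul_sandwich h0 hx1 (mul_mem_sandwich_left hz1 y2)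
    have e6 := sandwich_mul_sandwich h1 hx2 (mul_mem_sandwich_left hz2 y1)
    rw [← mul_assoc] at e5 e6
    simp only [add_mul, mul_add, e1, e2, e3, e4, e5, e6, zero_mul, add_zero]
  -- As C need not be unital, CaC = 0 does not give a = 0 at once. The elements x with CxC = 0 form
  -- a graded *-ideal containing a, and it is not C because some triple product is nonzero.
  have hA : IsGradedStarIdeal 𝒞 s
      { carrier := {x : C | ∀ b c, b * x * c = 0}
        add_mem' := fun {x y} hx hy b c => by simp [mul_add, add_mul, hx b c, hy b c]
        zero_mem' := fun b c => by simp
        smul_mem' := fun r x hx b c => by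
          rw [mul_smul_comm, smul_mul_assoc, hx b c, smul_zero] } :=
    { mul_mem_left := fun c x hx b d => by rw [← mul_assoc]; exact hx _ _
      mul_mem_right := fun c x hx b d => by rw [← mul_assoc, mul_assoc]; exact hx _ _
      graded := h.eq_iSup_inf_of_proj_mem fun g x hx b c => by
        rw [← h.sum_proj b, ← h.sum_proj c, Finset.sum_mul, Finset.sum_mul_sum]
        refine Finset.sum_eq_zero fun i _ => Finset.sum_eq_zero fun j _ => ?_
        rw [← h.proj_mul_left (h.proj_mem i b), ← h.proj_mul_right (h.proj_mem j c), hx, map_zero]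
      star_mem := fun x hx b c => by
        have := congrArg s (hx (s c) (s b))
        simpa [hs.map_mul, hs.involutive, mul_assoc] using this }
  rcases hC.eq_bot_or_eq_top _ hA with hb | ht
  · refine (Submodule.mem_bot F).1 (hb ▸ ?_)
    intro b c
    exact (Submodule.mem_bot F).1
      (hbot ▸ Submodule.mem_sup_left (mul_mul_mem_sandwich a b c))
  · have hy := (SetLike.ext_iff.1 ht y).2 Submodule.mem_top
    exact absurd (hy x z) hxyz

end Semiprime

/-! ### Primitive homogeneous idempotents -/

/-- `e` is a nonzero idempotent of degree `0` for which the graded left ideal `C e` is minimal. -/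
structure IsGradedPrimitive {F G C : Type*} [Field F] [AddCommGroup G] [NonUnitalRing C]
    [Module F C] (𝒞 : G → Submodule F C) (e : C) : Prop where
  mem : e ∈ 𝒞 0
  idem : e * e = e
  ne_zero : e ≠ 0
  exists_left_inv : ∀ g, ∀ x ∈ 𝒞 g, x * e = x → x ≠ 0 → ∃ c ∈ 𝒞 (-g), c * x = e

section Primitive

variable {F G C : Type*} [Field F] [AddCommGroup G] [DecidableEq G] [Fintype G]
  [NonUnitalRing C] [Module F C] [IsScalarTower F C C] [SMulCommClass F C C]
  {𝒞 : G → Submodule F C} {s : C →ₗ[F] C}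

/-- `L` is a graded left ideal. -/
structure IsGradedLeftIdeal (h : IsAlgGrading 𝒞) (L : Submodule F C) : Prop where
  mul_mem : ∀ c, ∀ x ∈ L, c * x ∈ L
  proj_mem : ∀ g, ∀ x ∈ L, h.proj g x ∈ L

theorem IsGradedLeftIdeal.map_mulRight {h : IsAlgGrading 𝒞} {L : Submodule F C}
    (hL : IsGradedLeftIdeal h L) {k : G} {a : C} (ha : a ∈ 𝒞 k) :
    IsGradedLeftIdeal h (L.map (LinearMap.mulRight F a)) where
  mul_mem := by
    rintro c _ ⟨y, hy, rfl⟩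
    exact ⟨c * y, hL.mul_mem c y hy, mul_assoc _ _ _⟩
  proj_mem := by
    rintro g _ ⟨y, hy, rfl⟩
    refine ⟨h.proj (g - k) y, hL.proj_mem _ y hy, ?_⟩
    simp only [LinearMap.mulRight_apply]
    rw [← h.proj_mul_right ha, sub_add_cancel]

theorem IsGradedLeftIdeal.inf_ker_mulRight {h : IsAlgGrading 𝒞} {L : Submodule F C}
    (hL : IsGradedLeftIdeal h L) {k : G} {a : C} (ha : a ∈ 𝒞 k) :
    IsGradedLeftIdeal h (L ⊓ LinearMap.ker (LinearMap.mulRight F a)) where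
  mul_mem := by
    rintro c y ⟨hy, hy'⟩
    refine ⟨hL.mul_mem c y hy, ?_⟩
    simp only [SetLike.mem_coe, LinearMap.mem_ker, LinearMap.mulRight_apply] at hy' ⊢
    rw [mul_assoc, hy', mul_zero]
  proj_mem := by
    rintro g y ⟨hy, hy'⟩
    refine ⟨hL.proj_mem g y hy, ?_⟩
    simp only [SetLike.mem_coe, LinearMap.mem_ker, LinearMap.mulRight_apply] at hy' ⊢
    rw [← h.proj_mul_right ha, hy', map_zero]

/-- Graded form of Brauer's lemma: in a semiprime algebra a minimal left ideal L contains a nonzero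
idempotent. Right multiplication by a suitable homogeneous y in L is a bijection of L, and the
idempotent is an element of L that fixes y. -/
theorem IsStarGradedSimple.exists_isGradedPrimitive [FiniteDimensional F C]
    (hC : IsStarGradedSimple 𝒞 s) (h : IsAlgGrading 𝒞) (hs : IsGradedInvolution 𝒞 s) :
    ∃ e, IsGradedPrimitive 𝒞 e := by
  have hwf : WellFounded ((· < ·) : Submodule F C → Submodule F C → Prop) := wellFounded_lt
  obtain ⟨L, ⟨hL0, hL⟩, hmin⟩ := hwf.has_min {L | L ≠ ⊥ ∧ IsGradedLeftIdeal h L} ⟨⊤, by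
    obtain ⟨a, b, hab⟩ := hC.exists_mul_ne_zero
    refine ⟨fun H => hab ?_, ⟨fun _ _ _ => trivial, fun _ _ _ => trivial⟩⟩
    exact (Submodule.mem_bot F).1 (H ▸ Submodule.mem_top)⟩
  have hmin' : ∀ I : Submodule F C, IsGradedLeftIdeal h I → I ≤ L → I ≠ ⊥ → I = L :=
    fun I hI hIL hI0 => by
      by_contra hne
      exact hmin I ⟨hI0, hI⟩ (lt_of_le_of_ne hIL hne)
  obtain ⟨x0, hx0L, hx0⟩ := Submodule.exists_mem_ne_zero_of_ne_bot hL0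
  obtain ⟨k, hk⟩ := h.exists_proj_ne_zero hx0
  set x := h.proj k x0 with hxdef
  have hx : x ∈ 𝒞 k := h.proj_mem _ _
  have hxL : x ∈ L := hL.proj_mem _ _ hx0L
  -- Semiprimeness supplies c, and one homogeneous component of c suffices. Then y = c_i x is a
  -- homogeneous element of L with xy ≠ 0.
  obtain ⟨c, hc⟩ : ∃ c, x * c * x ≠ 0 := by
    by_contra! H
    exact hk (hC.eq_zero_of_mul_mul_self h hs hx H)
  obtain ⟨i, hi⟩ : ∃ i, x * h.proj i c * x ≠ 0 := by
    by_contra! H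
    apply hc
    rw [← h.sum_proj c, Finset.mul_sum, Finset.sum_mul]
    exact Finset.sum_eq_zero fun i _ => H i
  set y := h.proj i c * x with hydef
  have hy : y ∈ 𝒞 (i + k) := h.mul_mem _ _ _ (h.proj_mem _ _) _ hx
  have hyL : y ∈ L := hL.mul_mem _ _ hxL
  have hxy : x * y ≠ 0 := by rwa [hydef, ← mul_assoc]
  have hLy : L.map (LinearMap.mulRight F y) = L := by
    refine hmin' _ (hL.map_mulRight hy) ?_ fun H => hxy ?_
    · rintro _ ⟨z, hz, rfl⟩
      exact hL.mul_mem _ _ hyL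
    · exact (Submodule.mem_bot F).1 (H ▸ ⟨x, hxL, rfl⟩)
  obtain ⟨l, hl, hly⟩ : y ∈ L.map (LinearMap.mulRight F y) := hLy.symm ▸ hyL
  -- Since y is homogeneous, ly = y already holds for the degree 0 component of l.
  set e := h.proj 0 l with hedef
  have heL : e ∈ L := hL.proj_mem _ _ hl
  have hey : e * y = y := by
    rw [hedef, ← h.proj_mul_right hy]
    simp only [LinearMap.mulRight_apply] at hly
    rw [hly, zero_add, h.proj_of_mem hy]
  have hker : L ⊓ LinearMap.ker (LinearMap.mulRight F y) = ⊥ := by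
    by_contra H
    have := hmin' _ (hL.inf_ker_mulRight hy) inf_le_left H
    rw [← this] at hxL
    exact hxy hxL.2
  have hy0 : y ≠ 0 := fun H => hxy (by rw [H, mul_zero])
  have hidem : e * e = e := by
    have : e * e - e ∈ L ⊓ LinearMap.ker (LinearMap.mulRight F y) :=
      ⟨sub_mem (hL.mul_mem _ _ heL) heL, by
        simp [sub_mul, mul_assoc, hey]⟩
    rw [hker] at this
    exact sub_eq_zero.1 ((Submodule.mem_bot F).1 this)
  refine ⟨e, h.proj_mem _ _, hidem, fun H => hy0 (by rw [← hey, H, zero_mul]), ?_⟩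
  intro g z hz hze hz0
  have hzL : z ∈ L := hze ▸ hL.mul_mem _ _ heL
  have hT : IsGradedLeftIdeal h (⊤ : Submodule F C) :=
    ⟨fun _ _ _ => trivial, fun _ _ _ => trivial⟩
  -- By semiprimeness Cz is nonzero; it is a graded left ideal inside L, so it equals L and contains
  -- e.
  have : (⊤ : Submodule F C).map (LinearMap.mulRight F z) = L := by
    refine hmin' _ (hT.map_mulRight hz) ?_ fun H => hz0 ?_
    · rintro _ ⟨w, _, rfl⟩
      exact hL.mul_mem _ _ hzL
    · refine hC.eq_zero_of_mul_mul_self h hs hz fun w => ?_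
      exact (Submodule.mem_bot F).1 (H ▸ ⟨z * w, trivial, rfl⟩)
  obtain ⟨w, _, hw⟩ := this.symm ▸ heL
  obtain ⟨w', hw', hw'z⟩ := h.exists_homogeneous_mul_eq hz (h.proj_mem 0 l) hw
  exact ⟨w', by simpa using hw', hw'z⟩

/-! ### The corner eCe as a graded division algebra. -/

namespace IsGradedPrimitive

variable {e : C}

theorem exists_left_inv_corner (he : IsGradedPrimitive 𝒞 e) (h : IsAlgGrading 𝒞) {g : G} {x : C}
    (hx : x ∈ 𝒞 g) (hxe : x * e = x) (hx0 : x ≠ 0) : ∃ c ∈ 𝒞 (-g), c * x = e ∧ e * c = c := by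
  obtain ⟨c, hc, hcx⟩ := he.exists_left_inv g x hx hxe hx0
  refine ⟨e * c, by simpa using h.mul_mem _ _ _ he.mem _ hc, ?_, ?_⟩
  · rw [mul_assoc, hcx, he.idem]
  · rw [← mul_assoc, he.idem]

/-- Nonzero homogeneous elements of the corner `e C e` are invertible. -/
theorem exists_inv_corner (he : IsGradedPrimitive 𝒞 e) (h : IsAlgGrading 𝒞) {g : G} {x : C}
    (hx : x ∈ 𝒞 g) (hex : e * x = x) (hxe : x * e = x) (hx0 : x ≠ 0) :
    ∃ c ∈ 𝒞 (-g), c * x = e ∧ x * c = e ∧ e * c = c ∧ c * e = c := by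
  have key : ∀ k : G, ∀ y ∈ 𝒞 k, e * y = y → y * e = y → y ≠ 0 →
      ∃ c ∈ 𝒞 (-k), c * y = e ∧ e * c = c ∧ c * e = c := by
    intro k y hy hey hye hy0
    obtain ⟨c, hc, hcy, hec⟩ := he.exists_left_inv_corner h hy hye hy0
    refine ⟨c * e, by simpa using h.mul_mem _ _ _ hc _ he.mem, ?_, ?_, ?_⟩
    · rw [mul_assoc, hey, hcy]
    · rw [← mul_assoc, hec]
    · rw [mul_assoc, he.idem]
  obtain ⟨c, hc, hcx, hec, hce⟩ := key g x hx hex hxe hx0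
  have hc0 : c ≠ 0 := fun H => he.ne_zero (by rw [← hcx, H, zero_mul])
  obtain ⟨d, hd, hdc, hed, hde⟩ := key _ c hc hec hce hc0
  refine ⟨c, hc, hcx, ?_, hec, hce⟩
  -- The left inverse d of the left inverse c is x itself, so c is a two-sided inverse.
  have : d = x := by
    calc d = d * (c * x) := by rw [hcx, hde]
      _ = x := by rw [← mul_assoc, hdc, hex]
  rw [← this, hdc]

theorem mul_ne_zero (he : IsGradedPrimitive 𝒞 e) {g : G} {x y : C}
    (hx : x ∈ 𝒞 g) (hxe : x * e = x) (hx0 : x ≠ 0) (hey : e * y = y) (hy0 : y ≠ 0) :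
    x * y ≠ 0 := by
  obtain ⟨c, _, hcx⟩ := he.exists_left_inv g x hx hxe hx0
  intro H
  apply hy0
  rw [← hey, ← hcx, mul_assoc, H, mul_zero]

/-- Left multiplication by x on the degree 0 part of the corner has an eigenvector y, with
eigenvalue r. Then x - r e kills y, but nonzero homogeneous elements of the corner are not zero
divisors. -/
theorem eq_smul_of_mem_zero [IsAlgClosed F] [FiniteDimensional F C]
    (he : IsGradedPrimitive 𝒞 e) (h : IsAlgGrading 𝒞) {x : C} (hx : x ∈ 𝒞 0) (hex : e * x = x)
    (hxe : x * e = x) : ∃ r : F, x = r • e := by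
  let D : Submodule F C :=
    𝒞 0 ⊓ (LinearMap.eqLocus (LinearMap.mulLeft F e) LinearMap.id) ⊓
      (LinearMap.eqLocus (LinearMap.mulRight F e) LinearMap.id)
  have hD : ∀ y, y ∈ D ↔ y ∈ 𝒞 0 ∧ e * y = y ∧ y * e = y := fun y => by
    simp [D, LinearMap.mem_eqLocus, and_assoc]
  have hmaps : ∀ y ∈ D, LinearMap.mulLeft F x y ∈ D := fun y hy => by
    rw [hD] at hy ⊢
    refine ⟨by simpa using h.mul_mem _ _ _ hx _ hy.1, ?_, ?_⟩
    · rw [LinearMap.mulLeft_apply, ← mul_assoc, hex]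
    · rw [LinearMap.mulLeft_apply, mul_assoc, hy.2.2]
  have : Nontrivial D := ⟨⟨⟨e, (hD e).2 ⟨he.mem, he.idem, he.idem⟩⟩, 0, fun H =>
    he.ne_zero (congrArg Subtype.val H)⟩⟩
  obtain ⟨r, hr⟩ := Module.End.exists_eigenvalue ((LinearMap.mulLeft F x).restrict hmaps)
  obtain ⟨⟨y, hy⟩, hy1, hy2⟩ := hr.exists_hasEigenvector
  rw [Module.End.mem_eigenspace_iff] at hy1
  have hxy : x * y = r • y := congrArg Subtype.val hy1
  have hy0 : y ≠ 0 := fun H => hy2 (Subtype.ext H)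
  have hyD := (hD y).1 hy
  refine ⟨r, ?_⟩
  by_contra hne
  refine he.mul_ne_zero (x := x - r • e) (y := y)
    (sub_mem hx (Submodule.smul_mem _ _ he.mem)) ?_ (sub_ne_zero.2 hne) hyD.2.1 hy0 ?_
  · rw [sub_mul, hxe, smul_mul_assoc, he.idem]
  · rw [sub_mul, smul_mul_assoc, hyD.2.1, hxy, sub_self]

/-- The homogeneous components of the corner are at most one-dimensional. -/
theorem eq_smul_of_mem [IsAlgClosed F] [FiniteDimensional F C]
    (he : IsGradedPrimitive 𝒞 e) (h : IsAlgGrading 𝒞) {g : G} {x y : C} (hx : x ∈ 𝒞 g)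
    (hex : e * x = x) (hxe : x * e = x) (hx0 : x ≠ 0) (hy : y ∈ 𝒞 g) (hey : e * y = y)
    (hye : y * e = y) : ∃ r : F, y = r • x := by
  obtain ⟨c, hc, -, hxc, hec, -⟩ := he.exists_inv_corner h hx hex hxe hx0
  obtain ⟨r, hr⟩ := he.eq_smul_of_mem_zero h (x := c * y)
    (by simpa using h.mul_mem _ _ _ hc _ hy) (by rw [← mul_assoc, hec]) (by rw [mul_assoc, hye])
  exact ⟨r, by rw [← hey, ← hxc, mul_assoc, hr, mul_smul_comm, hxe]⟩

/-- The degrees of the nonzero homogeneous elements of the corner `e C e`. -/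
def support (he : IsGradedPrimitive 𝒞 e) (h : IsAlgGrading 𝒞) : AddSubgroup G where
  carrier := {g | ∃ x ∈ 𝒞 g, e * x = x ∧ x * e = x ∧ x ≠ 0}
  zero_mem' := ⟨e, he.mem, he.idem, he.idem, he.ne_zero⟩
  add_mem' := by
    rintro g k ⟨x, hx, hex, hxe, hx0⟩ ⟨y, hy, hey, hye, hy0⟩
    exact ⟨x * y, h.mul_mem _ _ _ hx _ hy, by rw [← mul_assoc, hex], by rw [mul_assoc, hye],
      he.mul_ne_zero hx hxe hx0 hey hy0⟩
  neg_mem' := by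
    rintro g ⟨x, hx, hex, hxe, hx0⟩
    obtain ⟨c, hc, hcx, -, hec, hce⟩ := he.exists_inv_corner h hx hex hxe hx0
    exact ⟨c, hc, hec, hce, fun H => he.ne_zero (by rw [← hcx, H, zero_mul])⟩

end IsGradedPrimitive

/-- `u` identifies the group algebra of `H` with the corner `e C e`. -/
structure IsCornerBasis (𝒞 : G → Submodule F C) (e : C) {H : AddSubgroup G} (u : H → C) :
    Prop where
  mem : ∀ ξ : H, u ξ ∈ 𝒞 ξ
  mul : ∀ ξ ζ, u ξ * u ζ = u (ξ + ζ)
  zero : u 0 = e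
  span : ∀ g, ∀ x ∈ 𝒞 g, e * x = x → x * e = x → x ≠ 0 → ∃ (hg : g ∈ H) (r : F), x = r • u ⟨g, hg⟩

/-- Powers in the corner of the idempotent `e`. -/
def cornerPow (e x : C) : ℕ → C
  | 0 => e
  | n + 1 => cornerPow e x n * x

theorem cornerPow_mul_idem {e x : C} (he : e * e = e) (hxe : x * e = x) :
    ∀ n, cornerPow e x n * e = cornerPow e x n
  | 0 => he
  | n + 1 => by rw [cornerPow, mul_assoc, hxe]

theorem cornerPow_add {e x : C} (he : e * e = e) (hxe : x * e = x) (m : ℕ) :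
    ∀ n, cornerPow e x (m + n) = cornerPow e x m * cornerPow e x n
  | 0 => by rw [add_zero, cornerPow, cornerPow_mul_idem he hxe]
  | n + 1 => by rw [← add_assoc, cornerPow, cornerPow, cornerPow_add he hxe m n, mul_assoc]

theorem idem_mul_cornerPow {e x : C} (he : e * e = e) (hex : e * x = x) :
    ∀ n, e * cornerPow e x n = cornerPow e x n
  | 0 => he
  | n + 1 => by rw [cornerPow, ← mul_assoc, idem_mul_cornerPow he hex n]

theorem cornerPow_mem (h : IsAlgGrading 𝒞) {e x : C} (he : e ∈ 𝒞 0) {g : G} (hx : x ∈ 𝒞 g) :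
    ∀ n, cornerPow e x n ∈ 𝒞 (n • g)
  | 0 => by rw [zero_smul]; exact he
  | n + 1 => by
    rw [succ_nsmul, cornerPow]
    exact h.mul_mem _ _ _ (cornerPow_mem h he hx n) _ hx

theorem cornerPow_smul {e x : C} (r : F) :
    ∀ n, cornerPow e (r • x) n = r ^ n • cornerPow e x n
  | 0 => by simp [cornerPow]
  | n + 1 => by
    rw [cornerPow, cornerPow_smul r n, cornerPow, smul_mul_assoc, mul_smul_comm, smul_smul,
      pow_succ]

theorem cornerPow_mod {e x : C} (he : e * e = e) (hxe : x * e = x) {n : ℕ}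
    (hn : cornerPow e x n = e) (m : ℕ) : cornerPow e x m = cornerPow e x (m % n) := by
  have hk : ∀ k, cornerPow e x (n * k) = e := fun k => by
    induction k with
    | zero => rfl
    | succ k ih => rw [mul_add_one, cornerPow_add he hxe, ih, hn, he]
  conv_lhs => rw [← Nat.mod_add_div m n]
  rw [cornerPow_add he hxe, hk, cornerPow_mul_idem he hxe]

/-- Choose a nonzero x in the degree of a generator of the support, of order n. Its n-th power is a
nonzero scalar multiple of e, and rescaling x makes it e itself. The powers of x then depend only on
the exponent modulo n, and they form the required multiplicative basis. -/
theorem IsGradedPrimitive.exists_isCornerBasis [IsAlgClosed F] [FiniteDimensional F C]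
    [IsAddCyclic G] {e : C} (he : IsGradedPrimitive 𝒞 e) (h : IsAlgGrading 𝒞) :
    ∃ (H : AddSubgroup G) (u : H → C), IsCornerBasis 𝒞 e u := by
  set H := he.support h with hH
  obtain ⟨⟨g, hg⟩, hgen⟩ := IsAddCyclic.exists_generator (α := H)
  have hgen' : ∀ ξ : H, ∃ n : ℕ, n • (⟨g, hg⟩ : H) = ξ := fun ξ => by
    have := hgen ξ
    rwa [← mem_multiples_iff_mem_zmultiples] at this
  obtain ⟨x, hx, hex, hxe, hx0⟩ := hg
  have hn : 0 < addOrderOf g := addOrderOf_pos g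
  set n := addOrderOf g with hndef
  have hpow0 : ∀ m, cornerPow e x m ≠ 0 := fun m => by
    induction m with
    | zero => exact he.ne_zero
    | succ m ih =>
      exact he.mul_ne_zero (cornerPow_mem h he.mem hx m) (cornerPow_mul_idem he.idem hxe m) ih
        hex hx0
  obtain ⟨r, hr⟩ := he.eq_smul_of_mem_zero h (x := cornerPow e x n)
    (by simpa [hndef, addOrderOf_nsmul_eq_zero] using cornerPow_mem h he.mem hx n)
    (idem_mul_cornerPow he.idem hex n) (cornerPow_mul_idem he.idem hxe n)
  have hr0 : r ≠ 0 := by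
    rintro rfl
    exact hpow0 n (by rw [hr, zero_smul])
  obtain ⟨z, hz⟩ := IsAlgClosed.exists_pow_nat_eq r⁻¹ hn
  have hz0 : z ≠ 0 := by
    rintro rfl
    rw [zero_pow hn.ne'] at hz
    exact inv_ne_zero hr0 hz.symm
  set y := z • x with hy
  have hey : e * y = y := by rw [hy, mul_smul_comm, hex]
  have hye : y * e = y := by rw [hy, smul_mul_assoc, hxe]
  have hyn : cornerPow e y n = e := by
    rw [hy, cornerPow_smul, hr, hz, smul_smul, inv_mul_cancel₀ hr0, one_smul]
  have hyg : y ∈ 𝒞 g := Submodule.smul_mem _ _ hx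
  have hy0 : ∀ m, cornerPow e y m ≠ 0 := fun m => by
    rw [hy, cornerPow_smul]
    exact smul_ne_zero (pow_ne_zero _ hz0) (hpow0 m)
  choose m hm using hgen'
  have hmG : ∀ ξ : H, m ξ • g = ξ := fun ξ => congrArg Subtype.val (hm ξ)
  -- This makes the arbitrary choice of the exponents `m ξ` harmless.
  have hcongr : ∀ a b : ℕ, a • g = b • g → cornerPow e y a = cornerPow e y b := fun a b hab => by
    rw [cornerPow_mod he.idem hye hyn a, cornerPow_mod he.idem hye hyn b,
      nsmul_eq_nsmul_iff_modEq.1 hab]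
  have hmem : ∀ ξ : H, cornerPow e y (m ξ) ∈ 𝒞 ξ := fun ξ => by
    have := cornerPow_mem h he.mem hyg (m ξ)
    rwa [hmG] at this
  refine ⟨H, fun ξ => cornerPow e y (m ξ), hmem, fun ξ ζ => ?_, ?_, ?_⟩
  · rw [← cornerPow_add he.idem hye]
    refine hcongr _ _ ?_
    rw [add_nsmul, hmG, hmG, hmG, AddSubgroup.coe_add]
  · exact hcongr _ 0 (by rw [hmG, zero_nsmul, AddSubgroup.coe_zero])
  · intro k w hw hew hwe hw0
    refine ⟨⟨w, hw, hew, hwe, hw0⟩, he.eq_smul_of_mem h (hmem ⟨k, _⟩)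
      (idem_mul_cornerPow he.idem hey _) (cornerPow_mul_idem he.idem hye _) (hy0 _) hw hew hwe⟩

end Primitive

/-! ### Matrix units -/

section MatrixUnits

variable {F G C : Type*} [Field F] [AddCommGroup G] [DecidableEq G] [Fintype G]
  [NonUnitalRing C] [Module F C] [IsScalarTower F C C] [SMulCommClass F C C]
  {𝒞 : G → Submodule F C} {s : C →ₗ[F] C}

/-- There are no nonzero homogeneous `a` with `a C a = 0`. -/
def IsGradedSemiprime (𝒞 : G → Submodule F C) : Prop :=
  ∀ g, ∀ a ∈ 𝒞 g, (∀ c, a * c * a = 0) → a = 0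

theorem IsStarGradedSimple.isGradedSemiprime (hC : IsStarGradedSimple 𝒞 s)
    (h : IsAlgGrading 𝒞) (hs : IsGradedInvolution 𝒞 s) : IsGradedSemiprime 𝒞 :=
  fun _ _ ha h0 => hC.eq_zero_of_mul_mul_self h hs ha h0

/-- Homogeneous families `v` in `C e` and `w` in `e C` that are dual to each other. -/
structure IsDualSystem {ι : Type*} [DecidableEq ι] (𝒞 : G → Submodule F C) (e : C)
    (t : ι → G) (v w : ι → C) : Prop where
  left_mem : ∀ i, v i ∈ 𝒞 (-t i)
  right_mem : ∀ i, w i ∈ 𝒞 (t i)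
  left_mul : ∀ i, v i * e = v i
  mul_right : ∀ i, e * w i = w i
  pairing : ∀ i j, w i * v j = if i = j then e else 0

/-! ### Homogeneous dual bases of Ce and eC over the corner. -/

namespace IsDualSystem

variable {ι : Type*} [DecidableEq ι] {e : C} {t : ι → G} {v w : ι → C}

theorem comp (D : IsDualSystem 𝒞 e t v w) {κ : Type*} [DecidableEq κ] (f : κ ≃ ι) :
    IsDualSystem 𝒞 e (t ∘ f) (v ∘ f) (w ∘ f) where
  left_mem i := D.left_mem _
  right_mem i := D.right_mem _
  left_mul i := D.left_mul _
  mul_right i := D.mul_right _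
  pairing i j := by simp [D.pairing]

theorem linearIndependent (D : IsDualSystem 𝒞 e t v w) (he0 : e ≠ 0) :
    LinearIndependent F v := by
  rw [linearIndependent_iff']
  intro S c hc i hi
  have := congrArg (w i * ·) hc
  simp only [Finset.mul_sum, mul_smul_comm, D.pairing, mul_zero] at this
  rw [Finset.sum_eq_single i (by intro j _ hj; simp [hj.symm]) (fun H => absurd hi H)] at this
  simpa [he0] using this

variable [Fintype ι]

theorem card_le (D : IsDualSystem 𝒞 e t v w) (he0 : e ≠ 0) [FiniteDimensional F C] :
    Fintype.card ι ≤ Module.finrank F C :=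
  (D.linearIndependent he0).fintype_card_le_finrank

theorem sum_mem (D : IsDualSystem 𝒞 e t v w) (h : IsAlgGrading 𝒞) : ∑ i, v i * w i ∈ 𝒞 0 :=
  Submodule.sum_mem _ fun i _ => by
    simpa using h.mul_mem _ _ _ (D.left_mem i) _ (D.right_mem i)

/-- A dual system that is not complete has a nonzero homogeneous element in its residual space. -/
theorem exists_residual (D : IsDualSystem 𝒞 e t v w) (h : IsAlgGrading 𝒞)
    (he : IsGradedPrimitive 𝒞 e)
    (hne : ¬ ∀ x, x * e = x → (∑ i, v i * w i) * x = x) :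
    ∃ g, ∃ y ∈ 𝒞 g, y ≠ 0 ∧ y * e = y ∧ ∀ i, w i * y = 0 := by
  push Not at hne
  obtain ⟨x, hxe, hx⟩ := hne
  obtain ⟨g, hg⟩ := h.exists_proj_ne_zero (sub_ne_zero.2 hx)
  have hp : h.proj g ((∑ i, v i * w i) * x) = (∑ i, v i * w i) * h.proj g x := by
    simpa using h.proj_mul_left (D.sum_mem h) g x
  have hpe : h.proj g x * e = h.proj g x := by
    have := h.proj_mul_right he.mem g x
    rw [← this, hxe, add_zero]
  -- With f = ∑ v_i w_i one has w_i f = w_i, so every w_i kills fx - x and its homogeneous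
  -- components.
  refine ⟨g, h.proj g ((∑ i, v i * w i) * x - x), h.proj_mem _ _, hg, ?_, fun i => ?_⟩
  · rw [map_sub, hp, sub_mul, mul_assoc, hpe]
  · have h1 : w i * ∑ j, v j * w j = w i := by
      rw [Finset.mul_sum, Finset.sum_eq_single i]
      · rw [← mul_assoc, D.pairing, if_pos rfl, D.mul_right]
      · intro j _ hj
        rw [← mul_assoc, D.pairing, if_neg hj.symm, zero_mul]
      · simp
    rw [map_sub, hp, mul_sub, ← mul_assoc, h1, sub_self]

/-- A Gram–Schmidt step: adjoin a residual vector y. A left inverse c of y is replaced by c - cf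
with f = ∑ v_i w_i, which kills all old v_j and still satisfies (c - cf)y = e because fy = 0. -/
theorem extend (D : IsDualSystem 𝒞 e t v w) (h : IsAlgGrading 𝒞)
    (he : IsGradedPrimitive 𝒞 e)
    (hne : ¬ ∀ x, x * e = x → (∑ i, v i * w i) * x = x) :
    ∃ (t' : Option ι → G) (v' w' : Option ι → C), IsDualSystem 𝒞 e t' v' w' := by
  obtain ⟨g, y, hy, hy0, hye, hwy⟩ := D.exists_residual h he hne
  obtain ⟨c, hc, hcy, hec⟩ := he.exists_left_inv_corner h hy hye hy0
  refine ⟨fun i => i.elim (-g) t, fun i => i.elim y v,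
    fun i => i.elim (c - c * ∑ i, v i * w i) w, ?_, ?_, ?_, ?_, ?_⟩
  · rintro (_ | i)
    · simpa using hy
    · exact D.left_mem i
  · rintro (_ | i)
    · exact sub_mem hc (by simpa using h.mul_mem _ _ _ hc _ (D.sum_mem h))
    · exact D.right_mem i
  · rintro (_ | i)
    · exact hye
    · exact D.left_mul i
  · rintro (_ | i)
    · simp only [Option.elim_none, mul_sub, ← mul_assoc, hec]
    · exact D.mul_right i
  · rintro (_ | i) (_ | j)
    · simp [sub_mul, mul_assoc, Finset.sum_mul, hwy, hcy]
    · have : (∑ i, v i * w i) * v j = v j := by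
        simp [Finset.sum_mul, mul_assoc, D.pairing, D.left_mul]
      simp [sub_mul, mul_assoc, this]
    · simpa using hwy i
    · simpa using D.pairing i j

/-- A complete dual system also acts as the identity on `e C`. -/
theorem mul_sum_eq (D : IsDualSystem 𝒞 e t v w) (h : IsAlgGrading 𝒞)
    (he : IsGradedPrimitive 𝒞 e) (hsp : IsGradedSemiprime 𝒞)
    (hl : ∀ x, x * e = x → (∑ i, v i * w i) * x = x) {x : C} (hx : e * x = x) :
    x * (∑ i, v i * w i) = x := by
  have hf := D.sum_mem h
  set f := ∑ i, v i * w i with hfdef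
  -- Put a = yf - y. Since f is the identity on Ce, a c e = 0 for all c. As a = e a, also a c a = 0,
  -- and semiprimeness gives a = 0.
  have key : ∀ g, ∀ y ∈ 𝒞 g, e * y = y → y * f - y = 0 := fun g y hy hey => by
    refine hsp g _ (sub_mem (by simpa using h.mul_mem _ _ _ hy _ hf) hy) fun c => ?_
    have h1 : e * (y * f - y) = y * f - y := by rw [mul_sub, ← mul_assoc, hey]
    have h2 : (y * f - y) * c * e = 0 := by
      rw [mul_assoc, sub_mul, mul_assoc, hl (c * e) (by rw [mul_assoc, he.idem]), sub_self]
    rw [← h1, ← mul_assoc, h1, h2, zero_mul]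
  rw [← h.sum_proj x, Finset.sum_mul]
  refine Finset.sum_congr rfl fun g _ => sub_eq_zero.1 (key g _ (h.proj_mem g x) ?_)
  have := h.proj_mul_left he.mem g x
  rw [← this, hx, zero_add]

end IsDualSystem

/-- The largest n ≤ N with P n cannot be enlarged. This runs the maximality arguments for dual
systems and for frames, with N the dimension of C. -/
theorem exists_of_forall_extend {P : ℕ → Prop} {Q : Prop} (N : ℕ) (h0 : P 0)
    (hN : ∀ n, P n → n ≤ N) (hext : ∀ n, P n → Q ∨ ∃ m, n < m ∧ P m) : Q := by
  classical
  rcases hext _ (Nat.findGreatest_spec (Nat.zero_le N) h0) with hQ | ⟨m, hm, hPm⟩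
  · exact hQ
  · exact absurd (Nat.le_findGreatest (hN m hPm) hPm) (not_le.2 hm)

theorem IsGradedPrimitive.exists_complete_isDualSystem [FiniteDimensional F C] {e : C}
    (he : IsGradedPrimitive 𝒞 e) (h : IsAlgGrading 𝒞) :
    ∃ (k : ℕ) (t : Fin k → G) (v w : Fin k → C), IsDualSystem 𝒞 e t v w ∧
      ∀ x, x * e = x → (∑ i, v i * w i) * x = x := by
  refine exists_of_forall_extend
    (P := fun n => ∃ (t : Fin n → G) (v w : Fin n → C), IsDualSystem 𝒞 e t v w)
    (Module.finrank F C) ?_ ?_ ?_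
  · exact ⟨Fin.elim0, Fin.elim0, Fin.elim0, fun i => i.elim0, fun i => i.elim0, fun i => i.elim0,
      fun i => i.elim0, fun i => i.elim0⟩
  · rintro n ⟨t, v, w, D⟩
    simpa using D.card_le he.ne_zero
  · rintro n ⟨t, v, w, D⟩
    by_cases hc : ∀ x, x * e = x → (∑ i, v i * w i) * x = x
    · exact Or.inl ⟨n, t, v, w, D, hc⟩
    · obtain ⟨t', v', w', D'⟩ := D.extend h he hc
      exact Or.inr ⟨n + 1, n.lt_succ_self, _, _, _, D'.comp (finSuccEquiv n)⟩

/-- The linear map `η_ξ ↦ u ξ` on the group algebra. -/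
noncomputable def cornerMap {H : AddSubgroup G} (u : H → C) : AddMonoidAlgebra F H →ₗ[F] C :=
  Finsupp.linearCombination F u ∘ₗ (AddMonoidAlgebra.coeffLinearEquiv F).toLinearMap

/-! ### The corner as a copy of the group algebra. -/

namespace IsCornerBasis

variable {e : C} {H : AddSubgroup G} {u : H → C}

theorem cornerMap_single (u : H → C) (ξ : H) (r : F) :
    cornerMap u (AddMonoidAlgebra.single ξ r) = r • u ξ := by
  simp [cornerMap, AddMonoidAlgebra.coeff_single]

theorem idem_mul (hu : IsCornerBasis 𝒞 e u) (ξ : H) : e * u ξ = u ξ := by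
  rw [← hu.zero, hu.mul, zero_add]

theorem mul_idem (hu : IsCornerBasis 𝒞 e u) (ξ : H) : u ξ * e = u ξ := by
  rw [← hu.zero, hu.mul, add_zero]

theorem mul_neg (hu : IsCornerBasis 𝒞 e u) (ξ : H) : u ξ * u (-ξ) = e := by
  rw [hu.mul, add_neg_cancel, hu.zero]

theorem neg_mul (hu : IsCornerBasis 𝒞 e u) (ξ : H) : u (-ξ) * u ξ = e := by
  rw [hu.mul, neg_add_cancel, hu.zero]

theorem ne_zero (hu : IsCornerBasis 𝒞 e u) (he0 : e ≠ 0) (ξ : H) : u ξ ≠ 0 := fun H0 =>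
  he0 (by rw [← hu.mul_neg ξ, H0, zero_mul])

theorem cornerMap_mul (hu : IsCornerBasis 𝒞 e u) (a b : AddMonoidAlgebra F H) :
    cornerMap u (a * b) = cornerMap u a * cornerMap u b := by
  induction a using AddMonoidAlgebra.induction_linear with
  | zero => simp
  | add x y hx hy => rw [add_mul, map_add, hx, hy, map_add, add_mul]
  | single ξ r =>
    induction b using AddMonoidAlgebra.induction_linear with
    | zero => simp
    | add x y hx hy => rw [mul_add, map_add, hx, hy, map_add, mul_add]
    | single ζ r' =>
      rw [AddMonoidAlgebra.single_mul_single, cornerMap_single, cornerMap_single,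
        cornerMap_single, smul_mul_smul_comm, hu.mul]

theorem idem_mul_cornerMap (hu : IsCornerBasis 𝒞 e u) (a : AddMonoidAlgebra F H) :
    e * cornerMap u a = cornerMap u a := by
  induction a using AddMonoidAlgebra.induction_linear with
  | zero => simp
  | add x y hx hy => rw [map_add, mul_add, hx, hy]
  | single ξ r => rw [cornerMap_single, mul_smul_comm, hu.idem_mul]

theorem cornerMap_mul_idem (hu : IsCornerBasis 𝒞 e u) (a : AddMonoidAlgebra F H) :
    cornerMap u a * e = cornerMap u a := by
  induction a using AddMonoidAlgebra.induction_linear with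
  | zero => simp
  | add x y hx hy => rw [map_add, add_mul, hx, hy]
  | single ξ r => rw [cornerMap_single, smul_mul_assoc, hu.mul_idem]

/-- The `u ξ` are nonzero in distinct degrees, so the projection to degree ξ reads off the
coefficient of η_ξ. -/
theorem cornerMap_injective (hu : IsCornerBasis 𝒞 e u) (h : IsAlgGrading 𝒞) (he0 : e ≠ 0) :
    Function.Injective (cornerMap (F := F) u) := by
  have key : ∀ (a : AddMonoidAlgebra F H) (ξ : H),
      h.proj ξ (cornerMap u a) = a.coeff ξ • u ξ := fun a ξ => by
    induction a using AddMonoidAlgebra.induction_linear with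
    | zero => simp
    | add x y hx hy => rw [map_add, map_add, hx, hy, AddMonoidAlgebra.coeff_add, Finsupp.add_apply,
        add_smul]
    | single ζ r =>
      rw [cornerMap_single, map_smul, AddMonoidAlgebra.coeff_single]
      by_cases hζ : ζ = ξ
      · subst hζ
        rw [h.proj_of_mem (hu.mem ζ), Finsupp.single_eq_same]
      · rw [h.proj_of_mem_ne (hu.mem ζ) (fun H => hζ (Subtype.ext H)),
          Finsupp.single_eq_of_ne' hζ, zero_smul, smul_zero]
  rw [injective_iff_map_eq_zero]
  intro a ha
  ext ξ
  have := key a ξ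
  rw [ha, map_zero] at this
  simpa using (smul_eq_zero.1 this.symm).resolve_right (hu.ne_zero he0 ξ)

end IsCornerBasis

/-- The linear map `E_ij η_ξ ↦ v i * u ξ * w j`. -/
noncomputable def unitsMap {ι : Type*} [Fintype ι] {H : AddSubgroup G} (u : H → C) (v w : ι → C) :
    Matrix ι ι (AddMonoidAlgebra F H) →ₗ[F] C where
  toFun X := ∑ i, ∑ j, v i * cornerMap u (X i j) * w j
  map_add' X Y := by
    simp only [Matrix.add_apply, map_add, mul_add, add_mul, Finset.sum_add_distrib]
  map_smul' r X := by
    simp only [Matrix.smul_apply, map_smul, mul_smul_comm, smul_mul_assoc, Finset.smul_sum,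
      RingHom.id_apply]

/-! ### Matrix units from a dual system. -/

namespace IsDualSystem

variable {ι : Type*} [DecidableEq ι] [Fintype ι] {e : C} {t : ι → G} {v w : ι → C}
  {H : AddSubgroup G} {u : H → C}

theorem unitsMap_apply (u : H → C) (v w : ι → C) (X : Matrix ι ι (AddMonoidAlgebra F H)) :
    unitsMap u v w X = ∑ i, ∑ j, v i * cornerMap u (X i j) * w j := rfl

theorem unitsMap_homogMatrix (u : H → C) (v w : ι → C) (i j : ι) (ξ : H) :
    unitsMap (F := F) u v w (homogMatrix (Matrix.single i j 1) ξ) = v i * u ξ * w j := by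
  rw [unitsMap_apply, Finset.sum_eq_single i, Finset.sum_eq_single j]
  · simp [homogMatrix, IsCornerBasis.cornerMap_single]
  · intro k _ hk
    simp [homogMatrix, hk.symm]
  · simp
  · intro k _ hk
    refine Finset.sum_eq_zero fun l _ => ?_
    simp [homogMatrix, hk.symm]
  · simp

theorem unitsMap_mul_left (D : IsDualSystem 𝒞 e t v w) (hu : IsCornerBasis 𝒞 e u)
    (X : Matrix ι ι (AddMonoidAlgebra F H)) (k : ι) :
    unitsMap u v w X * v k = ∑ i, v i * cornerMap u (X i k) := by
  rw [unitsMap_apply, Finset.sum_mul]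
  refine Finset.sum_congr rfl fun i _ => ?_
  rw [Finset.sum_mul, Finset.sum_eq_single k]
  · rw [mul_assoc, D.pairing, if_pos rfl, mul_assoc, hu.cornerMap_mul_idem]
  · intro j _ hj
    rw [mul_assoc, D.pairing, if_neg hj, mul_zero]
  · simp

theorem unitsMap_mul (D : IsDualSystem 𝒞 e t v w) (hu : IsCornerBasis 𝒞 e u)
    (X Y : Matrix ι ι (AddMonoidAlgebra F H)) :
    unitsMap u v w (X * Y) = unitsMap u v w X * unitsMap u v w Y := by
  have hL : unitsMap u v w (X * Y) =
      ∑ i, ∑ l, ∑ k, v i * cornerMap u (X i k) * cornerMap u (Y k l) * w l := by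
    simp only [unitsMap_apply, Matrix.mul_apply, map_sum, hu.cornerMap_mul, Finset.sum_mul,
      Finset.mul_sum, mul_assoc]
  have hR : unitsMap u v w X * unitsMap u v w Y =
      ∑ k, ∑ l, ∑ i, v i * cornerMap u (X i k) * cornerMap u (Y k l) * w l := by
    rw [unitsMap_apply u v w Y]
    simp only [Finset.mul_sum, ← mul_assoc, D.unitsMap_mul_left hu X, Finset.sum_mul]
  rw [hL, hR]
  refine Finset.sum_comm.trans (Eq.trans ?_ Finset.sum_comm)
  exact Finset.sum_congr rfl fun l _ => Finset.sum_comm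

/-- The entries of X are recovered inside the corner, which gives injectivity of `unitsMap`. -/
theorem mul_unitsMap_mul (D : IsDualSystem 𝒞 e t v w) (hu : IsCornerBasis 𝒞 e u)
    (X : Matrix ι ι (AddMonoidAlgebra F H)) (i j : ι) :
    w i * unitsMap u v w X * v j = cornerMap u (X i j) := by
  rw [mul_assoc, D.unitsMap_mul_left hu, Finset.mul_sum, Finset.sum_eq_single i]
  · rw [← mul_assoc, D.pairing, if_pos rfl, hu.idem_mul_cornerMap]
  · intro k _ hk
    rw [← mul_assoc, D.pairing, if_neg hk.symm, zero_mul]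
  · simp

theorem unitsMap_injective (D : IsDualSystem 𝒞 e t v w) (hu : IsCornerBasis 𝒞 e u)
    (h : IsAlgGrading 𝒞) (he0 : e ≠ 0) : Function.Injective (unitsMap (F := F) u v w) := by
  intro X Y hXY
  ext1 i j
  apply hu.cornerMap_injective h he0
  rw [← D.mul_unitsMap_mul hu, hXY, D.mul_unitsMap_mul hu]

theorem unitsMap_mem (D : IsDualSystem 𝒞 e t v w) (hu : IsCornerBasis 𝒞 e u)
    (h : IsAlgGrading 𝒞) {g : G} {X : Matrix ι ι (AddMonoidAlgebra F H)}
    (hX : X ∈ groupMatrixGrading F H t g) : unitsMap u v w X ∈ 𝒞 g := by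
  refine (Submodule.span_le (p := (𝒞 g).comap (unitsMap u v w))).2 ?_ hX
  rintro _ ⟨i, j, ξ, rfl, rfl⟩
  simp only [Submodule.comap_coe, Set.mem_preimage, unitsMap_homogMatrix]
  exact h.mul_mem _ _ _ (h.mul_mem _ _ _ (D.left_mem i) _ (hu.mem ξ)) _ (D.right_mem j)

/-- Peirce decomposition: with f = ∑ v_i w_i, fxf is the sum of the v_i (w_i x v_j) w_j, and each
w_i x v_j is a homogeneous element of the corner, hence zero or a multiple of some `u ξ`. Only fxf =
x is required, so the exchange case, where f is not the identity of C, is covered. -/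
theorem exists_unitsMap_eq (D : IsDualSystem 𝒞 e t v w) (hu : IsCornerBasis 𝒞 e u)
    (h : IsAlgGrading 𝒞) {g : G} {x : C} (hx : x ∈ 𝒞 g)
    (hxx : (∑ i, v i * w i) * x * (∑ i, v i * w i) = x) :
    ∃ X ∈ groupMatrixGrading F H t g, unitsMap u v w X = x := by
  have key : ∀ i j, ∃ X ∈ groupMatrixGrading F H t g,
      unitsMap u v w X = v i * (w i * x * v j) * w j := fun i j => by
    by_cases h0 : w i * x * v j = 0
    · exact ⟨0, zero_mem _, by rw [h0, map_zero, mul_zero, zero_mul]⟩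
    · obtain ⟨hg, r, hr⟩ := hu.span (t i + g + -t j) _
        (h.mul_mem _ _ _ (h.mul_mem _ _ _ (D.right_mem i) _ hx) _ (D.left_mem j))
        (by rw [← mul_assoc, ← mul_assoc, D.mul_right]) (by rw [mul_assoc, D.left_mul]) h0
      refine ⟨r • homogMatrix (Matrix.single i j 1) ⟨_, hg⟩, Submodule.smul_mem _ _
        (Submodule.subset_span ⟨i, j, ⟨_, hg⟩, by simp; abel, rfl⟩), ?_⟩
      rw [map_smul, unitsMap_homogMatrix, hr, mul_smul_comm, smul_mul_assoc]
  choose X hX hXe using key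
  refine ⟨∑ i, ∑ j, X i j, Submodule.sum_mem _ fun i _ => Submodule.sum_mem _ fun j _ => hX i j, ?_⟩
  simp only [map_sum, hXe]
  conv_rhs => rw [← hxx]
  simp only [Finset.sum_mul, Finset.mul_sum, mul_assoc]
  rw [Finset.sum_comm]

/-- A complete dual system identifies `C` with a matrix algebra over the group algebra. -/
theorem exists_linearEquiv (D : IsDualSystem 𝒞 e t v w) (hu : IsCornerBasis 𝒞 e u)
    (h : IsAlgGrading 𝒞) (he0 : e ≠ 0) (hl : ∀ x, (∑ i, v i * w i) * x = x)
    (hr : ∀ x, x * (∑ i, v i * w i) = x) :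
    ∃ φ : C ≃ₗ[F] Matrix ι ι (AddMonoidAlgebra F H), (∀ a b, φ (a * b) = φ a * φ b) ∧
      (∀ g, (𝒞 g).map (φ : C →ₗ[F] Matrix ι ι (AddMonoidAlgebra F H)) =
        groupMatrixGrading F H t g) ∧
      ∀ i j ξ, φ (v i * u ξ * w j) = homogMatrix (Matrix.single i j 1) ξ := by
  have hsurj : ∀ g, ∀ x ∈ 𝒞 g, ∃ X ∈ groupMatrixGrading F H t g, unitsMap u v w X = x :=
    fun g x hx => D.exists_unitsMap_eq hu h hx (by rw [hl, hr])
  have hbij : Function.Bijective (unitsMap (F := F) u v w) := by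
    refine ⟨D.unitsMap_injective hu h he0, fun x => ?_⟩
    choose X _ hX using fun g => hsurj g _ (h.proj_mem g x)
    exact ⟨∑ g, X g, by rw [map_sum]; simp only [hX, h.sum_proj]⟩
  let ψ := LinearEquiv.ofBijective (unitsMap u v w) hbij
  have hψ : ∀ X, ψ X = unitsMap u v w X := fun X => rfl
  refine ⟨ψ.symm, fun a b => ?_, fun g => ?_, fun i j ξ => ?_⟩
  · rw [LinearEquiv.symm_apply_eq, hψ, D.unitsMap_mul hu, ← hψ, ← hψ, ψ.apply_symm_apply,
      ψ.apply_symm_apply]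
  · apply le_antisymm
    · rintro _ ⟨x, hx, rfl⟩
      obtain ⟨X, hX, rfl⟩ := hsurj g x hx
      rw [← hψ]
      simpa using hX
    · intro X hX
      exact ⟨ψ X, D.unitsMap_mem hu h hX, by simp⟩
  · rw [LinearEquiv.symm_apply_eq, hψ, unitsMap_homogMatrix]

end IsDualSystem

end MatrixUnits

/-! ### The exchange case -/

section Exchange

variable {F G C : Type*} [Field F] [AddCommGroup G] [DecidableEq G] [Fintype G]
  [NonUnitalRing C] [Module F C] [IsScalarTower F C C] [SMulCommClass F C C]
  {𝒞 : G → Submodule F C} {s : C →ₗ[F] C}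
  {ι : Type*} [DecidableEq ι] [Fintype ι] {e : C} {t : ι → G} {v w : ι → C}
  {H : AddSubgroup G} {u : H → C}

theorem IsDualSystem.unitsMap_mem_sandwich (D : IsDualSystem 𝒞 e t v w)
    (X : Matrix ι ι (AddMonoidAlgebra F H)) : unitsMap u v w X ∈ sandwich F e := by
  rw [IsDualSystem.unitsMap_apply]
  refine Submodule.sum_mem _ fun i _ => Submodule.sum_mem _ fun j _ => ?_
  rw [← D.left_mul i, mul_assoc]
  exact mul_mul_mem_sandwich _ _ _

theorem IsDualSystem.sum_mem_sandwich (D : IsDualSystem 𝒞 e t v w) :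
    ∑ i, v i * w i ∈ sandwich F e :=
  Submodule.sum_mem _ fun i _ => by
    rw [← D.left_mul i]
    exact mul_mul_mem_sandwich _ _ _

theorem IsDualSystem.sum_mul_of_mem_sandwich (he : IsGradedPrimitive 𝒞 e)
    (hl : ∀ x, x * e = x → (∑ i, v i * w i) * x = x) {x : C} (hx : x ∈ sandwich F e) :
    (∑ i, v i * w i) * x = x := by
  rw [← sub_eq_zero, ← Submodule.mem_bot F]
  refine (LinearMap.map_mem_of_span
    (f := LinearMap.mulLeft F (∑ i, v i * w i) - LinearMap.id) ?_ hx :)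
  rintro _ ⟨b, c, rfl⟩
  simp only [LinearMap.sub_apply, LinearMap.mulLeft_apply, LinearMap.id_apply, Submodule.mem_bot]
  rw [← mul_assoc, hl (b * e) (by rw [mul_assoc, he.idem]), sub_self]

theorem IsDualSystem.mul_sum_of_mem_sandwich (D : IsDualSystem 𝒞 e t v w) (h : IsAlgGrading 𝒞)
    (he : IsGradedPrimitive 𝒞 e) (hsp : IsGradedSemiprime 𝒞)
    (hl : ∀ x, x * e = x → (∑ i, v i * w i) * x = x) {x : C} (hx : x ∈ sandwich F e) :
    x * (∑ i, v i * w i) = x := by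
  rw [← sub_eq_zero, ← Submodule.mem_bot F]
  refine (LinearMap.map_mem_of_span
    (f := LinearMap.mulRight F (∑ i, v i * w i) - LinearMap.id) ?_ hx :)
  rintro _ ⟨b, c, rfl⟩
  simp only [LinearMap.sub_apply, LinearMap.mulRight_apply, LinearMap.id_apply, Submodule.mem_bot]
  rw [mul_assoc b, mul_assoc b, D.mul_sum_eq h he hsp hl (x := e * c)
    (by rw [← mul_assoc, he.idem]), sub_self]

theorem sandwich_sup_star_eq_top (hC : IsStarGradedSimple 𝒞 s) (h : IsAlgGrading 𝒞)
    (hs : IsGradedInvolution 𝒞 s) (he : IsGradedPrimitive 𝒞 e) :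
    sandwich F e ⊔ sandwich F (s e) = ⊤ := by
  refine (hC.eq_bot_or_eq_top _ (isGradedStarIdeal_sandwich_sup h hs he.mem)).resolve_left
    fun hb => he.ne_zero ((Submodule.mem_bot F).1 (hb ▸ Submodule.mem_sup_left ?_))
  have := mul_mul_mem_sandwich (F := F) e e e
  rwa [he.idem, he.idem] at this

/-- For homogeneous b in eCe*, every product b x b contains a factor from e*Ce = 0, so b = 0 by
semiprimeness. -/
theorem IsGradedPrimitive.mul_mul_star_eq_zero (he : IsGradedPrimitive 𝒞 e) (h : IsAlgGrading 𝒞)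
    (hs : IsGradedInvolution 𝒞 s) (hsp : IsGradedSemiprime 𝒞) (h0 : ∀ c, s e * c * e = 0) (c : C) :
    e * c * s e = 0 := by
  rw [← h.sum_proj c, Finset.mul_sum, Finset.sum_mul]
  refine Finset.sum_eq_zero fun g _ => hsp _ _ (h.mul_mem _ _ _
    (h.mul_mem _ _ _ he.mem _ (h.proj_mem g c)) _ (hs.map_mem _ _ he.mem)) fun x => ?_
  have : e * h.proj g c * s e * x * (e * h.proj g c * s e) =
      e * h.proj g c * (s e * x * e) * (h.proj g c * s e) := by simp only [mul_assoc]
  rw [this, h0, mul_zero, zero_mul]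

/-- If `e^* C e = 0`, then `C` is the product of a matrix algebra and its opposite. -/
theorem IsDualSystem.gradedStarIsomorphic_prodOp (D : IsDualSystem 𝒞 e t v w)
    (hC : IsStarGradedSimple 𝒞 s) (h : IsAlgGrading 𝒞) (hs : IsGradedInvolution 𝒞 s)
    (he : IsGradedPrimitive 𝒞 e) (hu : IsCornerBasis 𝒞 e u)
    (hl : ∀ x, x * e = x → (∑ i, v i * w i) * x = x) (h0 : ∀ c, s e * c * e = 0) :
    GradedStarIsomorphic 𝒞 s (prodOpGrading (groupMatrixGrading F H t))
      (exchangeInvolution F (Matrix ι ι (AddMonoidAlgebra F H))) := by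
  have hsp := hC.isGradedSemiprime h hs
  have h1 := he.mul_mul_star_eq_zero h hs hsp h0
  have hf := D.sum_mem h
  have hfe : ∑ i, v i * w i ∈ sandwich F e := D.sum_mem_sandwich
  set f := ∑ i, v i * w i with hfdef
  have hfl : ∀ x ∈ sandwich F e, f * x = x := fun x hx =>
    IsDualSystem.sum_mul_of_mem_sandwich he hl hx
  have hfr : ∀ x ∈ sandwich F e, x * f = x := fun x hx =>
    D.mul_sum_of_mem_sandwich h he hsp hl hx
  have hss : ∀ x ∈ sandwich F (s e), s x ∈ sandwich F e := fun x hx => by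
    have := star_mem_sandwich hs hx
    rwa [hs.involutive] at this
  -- The element f is the identity of CeC and annihilates Ce*C from the left. The two summands are
  -- therefore the components of x in CeC and Ce*C.
  have hdec : ∀ x, x = f * x * f + s (f * s x * f) := fun x => by
    obtain ⟨y, hy, z, hz, rfl⟩ :=
      Submodule.mem_sup.1 ((sandwich_sup_star_eq_top hC h hs he).symm ▸ Submodule.mem_top (x := x))
    rw [map_add, mul_add, add_mul, mul_add, add_mul, hfl y hy, hfr y hy,
      sandwich_mul_sandwich h1 hfe hz, sandwich_mul_sandwich h1 hfe (star_mem_sandwich hs hy),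
      hfl _ (hss z hz), hfr _ (hss z hz)]
    simp [hs.involutive]
  let Φ := unitsMap (F := F) u v w
  have hΦe : ∀ X, Φ X ∈ sandwich F e := D.unitsMap_mem_sandwich
  -- The map is (X, Y) ↦ Φ(X) + Φ(Y)*. It is multiplicative because * reverses products, as the
  -- opposite algebra does, and the two ideals annihilate each other.
  let Ψ : (Matrix ι ι (AddMonoidAlgebra F H) × (Matrix ι ι (AddMonoidAlgebra F H))ᵐᵒᵖ) →ₗ[F] C :=
    Φ.coprod (s ∘ₗ Φ ∘ₗ (MulOpposite.opLinearEquiv F).symm.toLinearMap)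
  have hΨ : ∀ X, Ψ X = Φ X.1 + s (Φ X.2.unop) := fun X => rfl
  have hsurj : ∀ g, ∀ x ∈ 𝒞 g, ∃ X ∈ prodOpGrading (groupMatrixGrading F H t) g, Ψ X = x := by
    intro g x hx
    have key : ∀ y ∈ 𝒞 g, ∃ X ∈ groupMatrixGrading F H t g, Φ X = f * y * f := fun y hy => by
      refine D.exists_unitsMap_eq hu h
        (by simpa using h.mul_mem _ _ _ (h.mul_mem _ _ _ hf _ hy) _ hf) ?_
      rw [hfl _ (mul_mem_sandwich_left hfe _), hfr _ (mul_mem_sandwich_left hfe _)]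
    obtain ⟨X, hX, hXx⟩ := key x hx
    obtain ⟨Y, hY, hYx⟩ := key (s x) (hs.map_mem _ _ hx)
    refine ⟨(X, MulOpposite.op Y), ⟨hX, Y, hY, rfl⟩, ?_⟩
    rw [hΨ, hXx, MulOpposite.unop_op, hYx, ← hdec]
  have hbij : Function.Bijective Ψ := by
    constructor
    · rw [injective_iff_map_eq_zero]
      rintro ⟨X, Y⟩ hXY
      rw [hΨ] at hXY
      have hX : Φ X = 0 := by
        have := congrArg (f * ·) hXY
        simpa only [mul_add, hfl _ (hΦe X), mul_zero,
          sandwich_mul_sandwich h1 hfe (star_mem_sandwich hs (hΦe Y.unop)), add_zero] using this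
      have hY : Φ Y.unop = 0 := by
        rw [hX, zero_add] at hXY
        rw [← hs.involutive (Φ Y.unop), hXY, map_zero]
      have hinj := D.unitsMap_injective hu h he.ne_zero
      rw [injective_iff_map_eq_zero] at hinj
      exact Prod.ext (hinj _ hX) (MulOpposite.unop_injective (hinj _ hY))
    · intro x
      choose X _ hX using fun g => hsurj g _ (h.proj_mem g x)
      exact ⟨∑ g, X g, by rw [map_sum]; simp only [hX, h.sum_proj]⟩
  let ψ := LinearEquiv.ofBijective Ψ hbij
  have hψ : ∀ X, ψ X = Φ X.1 + s (Φ X.2.unop) := fun X => rfl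
  refine ⟨ψ.symm, fun a b => ?_, fun a => ?_, fun g => ?_⟩
  · obtain ⟨X, rfl⟩ := ψ.surjective a
    obtain ⟨Y, rfl⟩ := ψ.surjective b
    rw [LinearEquiv.symm_apply_eq, ψ.symm_apply_apply, ψ.symm_apply_apply, hψ, hψ, hψ, mul_add,
      add_mul, add_mul, sandwich_mul_sandwich h1 (hΦe _) (star_mem_sandwich hs (hΦe _)),
      sandwich_mul_sandwich h0 (star_mem_sandwich hs (hΦe _)) (hΦe _), ← hs.map_mul,
      ← D.unitsMap_mul hu, ← D.unitsMap_mul hu]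
    simp [Φ]
  · obtain ⟨X, rfl⟩ := ψ.surjective a
    rw [LinearEquiv.symm_apply_eq, ψ.symm_apply_apply, hψ, hψ, map_add, hs.involutive, add_comm]
    rfl
  · apply le_antisymm
    · rintro _ ⟨x, hx, rfl⟩
      obtain ⟨X, hX, rfl⟩ := hsurj g x hx
      have : ψ.symm (Ψ X) = X := ψ.symm_apply_apply X
      simpa [this] using hX
    · rintro ⟨X, Y⟩ ⟨hX, Z, hZ, rfl⟩
      refine ⟨ψ (X, MulOpposite.op Z), ?_, by simp⟩
      exact add_mem (D.unitsMap_mem hu h hX) (hs.map_mem _ _ (D.unitsMap_mem hu h hZ))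

end Exchange

/-! ### Graded simplicity of the model algebras -/

section Models

variable {F G : Type*} [Field F]

theorem GradedStarIsomorphic.isStarGradedSimple {A B : Type*} [NonUnitalRing A]
    [Module F A] [NonUnitalRing B] [Module F B] {𝒜 : G → Submodule F A} {σ : A →ₗ[F] A}
    {ℬ : G → Submodule F B} {τ : B →ₗ[F] B} (hiso : GradedStarIsomorphic 𝒜 σ ℬ τ)
    (hB : IsStarGradedSimple ℬ τ) : IsStarGradedSimple 𝒜 σ := by
  obtain ⟨φ, hmul, hstar, hgr⟩ := hiso
  refine ⟨?_, fun I hI => ?_⟩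
  · obtain ⟨a, b, hab⟩ := hB.exists_mul_ne_zero
    refine ⟨φ.symm a, φ.symm b, fun H => hab ?_⟩
    have := congrArg φ H
    simpa [hmul] using this
  · have hJ : IsGradedStarIdeal ℬ τ (I.map (φ : A →ₗ[F] B)) :=
      { mul_mem_left := by
          rintro a _ ⟨x, hx, rfl⟩
          exact ⟨φ.symm a * x, hI.mul_mem_left _ x hx, by simp [hmul]⟩
        mul_mem_right := by
          rintro a _ ⟨x, hx, rfl⟩
          exact ⟨x * φ.symm a, hI.mul_mem_right _ x hx, by simp [hmul]⟩
        graded := by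
          conv_lhs => rw [hI.graded]
          rw [Submodule.map_iSup]
          refine iSup_congr fun g => ?_
          rw [Submodule.map_inf _ φ.injective, hgr]
        star_mem := by
          rintro _ ⟨x, hx, rfl⟩
          exact ⟨σ x, hI.star_mem x hx, by simp [hstar]⟩ }
    have hcomap : I = (I.map (φ : A →ₗ[F] B)).comap (φ : A →ₗ[F] B) :=
      (Submodule.comap_map_eq_of_injective φ.injective I).symm
    rcases hB.eq_bot_or_eq_top _ hJ with hb | ht
    · left
      rw [hcomap, hb]
      exact LinearMap.ker_eq_bot.2 φ.injective
    · right
      rw [hcomap, ht]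
      rfl

theorem IsGradedStarIdeal.exists_homogeneous_ne_zero {A : Type*} [NonUnitalRing A] [Module F A]
    {𝒜 : G → Submodule F A} {σ : A →ₗ[F] A} {I : Submodule F A} (hI : IsGradedStarIdeal 𝒜 σ I)
    (hI0 : I ≠ ⊥) : ∃ g, ∃ x ∈ I, x ∈ 𝒜 g ∧ x ≠ 0 := by
  by_contra! H
  apply hI0
  rw [hI.graded, iSup_eq_bot]
  intro g
  rw [Submodule.eq_bot_iff]
  exact fun x hx => H g x hx.1 hx.2

theorem Matrix.eq_top_of_single_mem {R ι : Type*} [Ring R] [Module F R] [Fintype ι]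
    [DecidableEq ι] {I : Submodule F (Matrix ι ι R)} (hl : ∀ a, ∀ x ∈ I, a * x ∈ I)
    {i j : ι} {r q : R} (hr : Matrix.single i j r ∈ I) (hq : q * r = 1)
    (hR : ∀ a, ∀ x ∈ I, x * a ∈ I) : I = ⊤ := by
  rw [Submodule.eq_top_iff']
  intro X
  have key : ∀ a b (x : R), Matrix.single a b x ∈ I := fun a b x => by
    have := hR (Matrix.single j b 1) _ (hl (Matrix.single a i (x * q)) _ hr)
    simpa [mul_assoc, hq] using this
  rw [Matrix.matrix_eq_sum_single X]
  exact Submodule.sum_mem _ fun a _ => Submodule.sum_mem _ fun b _ => key a b _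

theorem Matrix.single_mem_of_mem {R ι : Type*} [Ring R] [Module F R] [Fintype ι]
    [DecidableEq ι] {I : Submodule F (Matrix ι ι R)} (hl : ∀ a, ∀ x ∈ I, a * x ∈ I)
    (hR : ∀ a, ∀ x ∈ I, x * a ∈ I) {X : Matrix ι ι R} (hX : X ∈ I) (i j : ι) :
    Matrix.single i j (X i j) ∈ I := by
  have := hR (Matrix.single j j 1) _ (hl (Matrix.single i i 1) _ hX)
  rwa [Matrix.single_mul_mul_single, one_mul, mul_one] at this

theorem isStarGradedSimple_matrix {ι : Type*} [Fintype ι] [DecidableEq ι] [Nonempty ι]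
    (ℬ : G → Submodule F (Matrix ι ι F)) (τ : Matrix ι ι F →ₗ[F] Matrix ι ι F) :
    IsStarGradedSimple ℬ τ := by
  refine ⟨⟨1, 1, by simp⟩, fun I hI => or_iff_not_imp_left.2 fun hI0 => ?_⟩
  obtain ⟨X, hX, hX0⟩ := Submodule.exists_mem_ne_zero_of_ne_bot hI0
  obtain ⟨i, j, hij⟩ : ∃ i j, X i j ≠ 0 := by
    by_contra! H
    exact hX0 (Matrix.ext H)
  exact Matrix.eq_top_of_single_mem hI.mul_mem_left
    (Matrix.single_mem_of_mem hI.mul_mem_left hI.mul_mem_right hX i j) (inv_mul_cancel₀ hij)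
    hI.mul_mem_right

variable [AddCommGroup G]

/-- At position (i, j) the degree g determines ξ = t_i + g - t_j, so a homogeneous matrix has
monomial entries. -/
theorem groupMatrixGrading_apply {ι : Type*} [DecidableEq ι] {H : AddSubgroup G} {t : ι → G}
    {g : G} {X : Matrix ι ι (AddMonoidAlgebra F H)} (hX : X ∈ groupMatrixGrading F H t g)
    (i j : ι) : X i j = 0 ∨ ∃ (ξ : H) (r : F), X i j = AddMonoidAlgebra.single ξ r := by
  suffices key : ∀ ξ : H, -t i + ξ + t j ≠ g → (X i j).coeff ξ = 0 by
    by_cases hg : ∃ ξ : H, -t i + ξ + t j = g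
    · obtain ⟨ξ, hξ⟩ := hg
      refine Or.inr ⟨ξ, (X i j).coeff ξ, ?_⟩
      ext ζ
      rw [AddMonoidAlgebra.coeff_single]
      by_cases hζ : ζ = ξ
      · rw [hζ, Finsupp.single_eq_same]
      · rw [Finsupp.single_eq_of_ne hζ, key]
        intro h
        rw [← hξ] at h
        exact hζ (Subtype.ext (add_left_cancel (add_right_cancel h)))
    · left
      ext ξ
      exact key ξ fun h => hg ⟨ξ, h⟩
  intro ξ hξ
  induction hX using Submodule.span_induction with
  | mem X hX =>
    obtain ⟨a, b, ζ, hζ, rfl⟩ := hX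
    by_cases hab : a = i ∧ b = j
    · obtain ⟨rfl, rfl⟩ := hab
      have : ζ ≠ ξ := fun H => hξ (H ▸ hζ)
      simp [homogMatrix, AddMonoidAlgebra.coeff_single, Finsupp.single_eq_of_ne' this]
    · simp [homogMatrix, Matrix.single_apply_of_ne (h := hab)]
  | zero => simp
  | add X Y _ _ hX hY => simp [hX, hY]
  | smul c X _ hX => simp [hX]

/-- A nonzero entry is a monomial r η_ξ, with inverse r⁻¹ η_{-ξ}. Homogeneity is essential, since
F[H] itself need not be simple. -/
theorem eq_top_of_homogeneous_mem {ι : Type*} [Fintype ι] [DecidableEq ι] {H : AddSubgroup G}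
    {t : ι → G} {g : G} {X : Matrix ι ι (AddMonoidAlgebra F H)}
    (hX : X ∈ groupMatrixGrading F H t g) (hX0 : X ≠ 0)
    {I : Submodule F (Matrix ι ι (AddMonoidAlgebra F H))} (hl : ∀ a, ∀ x ∈ I, a * x ∈ I)
    (hR : ∀ a, ∀ x ∈ I, x * a ∈ I) (hXI : X ∈ I) : I = ⊤ := by
  obtain ⟨i, j, hij⟩ : ∃ i j, X i j ≠ 0 := by
    by_contra! H
    exact hX0 (Matrix.ext H)
  obtain ⟨ξ, r, hr⟩ := (groupMatrixGrading_apply hX i j).resolve_left hij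
  have hr0 : r ≠ 0 := by
    rintro rfl
    exact hij (by rw [hr, AddMonoidAlgebra.single_zero])
  refine Matrix.eq_top_of_single_mem hl (Matrix.single_mem_of_mem hl hR hXI i j)
    (q := AddMonoidAlgebra.single (-ξ) r⁻¹) ?_ hR
  rw [hr, AddMonoidAlgebra.single_mul_single, neg_add_cancel, inv_mul_cancel₀ hr0,
    AddMonoidAlgebra.one_def]

theorem isStarGradedSimple_groupMatrix {ι : Type*} [Fintype ι] [DecidableEq ι] [Nonempty ι]
    (H : AddSubgroup G) (t : ι → G)
    (τ : Matrix ι ι (AddMonoidAlgebra F H) →ₗ[F] Matrix ι ι (AddMonoidAlgebra F H)) :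
    IsStarGradedSimple (groupMatrixGrading F H t) τ := by
  refine ⟨⟨1, 1, by simp⟩, fun I hI => or_iff_not_imp_left.2 fun hI0 => ?_⟩
  obtain ⟨g, X, hXI, hX, hX0⟩ := hI.exists_homogeneous_ne_zero hI0
  exact eq_top_of_homogeneous_mem hX hX0 hI.mul_mem_left hI.mul_mem_right hXI

theorem isStarGradedSimple_prodOp {ι : Type*} [Fintype ι] [DecidableEq ι] [Nonempty ι]
    (H : AddSubgroup G) (t : ι → G) :
    IsStarGradedSimple (prodOpGrading (groupMatrixGrading F H t))
      (exchangeInvolution F (Matrix ι ι (AddMonoidAlgebra F H))) := by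
  refine ⟨⟨1, 1, by simp⟩, fun I hI => or_iff_not_imp_left.2 fun hI0 => ?_⟩
  obtain ⟨g, ⟨X, Y⟩, hXYI, hXY, hXY0⟩ := hI.exists_homogeneous_ne_zero hI0
  -- The exchange involution carries the first factor onto the second.
  suffices hinl : ∀ Z, (Z, 0) ∈ I by
    rw [Submodule.eq_top_iff']
    rintro ⟨Z, W⟩
    have := add_mem (hinl Z) (hI.star_mem _ (hinl W.unop))
    simpa [exchangeInvolution] using this
  -- Multiplication by (1, 0) isolates a component; if the first one is zero, the exchange is
  -- applied beforehand.
  obtain ⟨Z, hZ, hZ0, hZI⟩ : ∃ Z ∈ groupMatrixGrading F H t g, Z ≠ 0 ∧ (Z, 0) ∈ I := by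
    obtain ⟨hX, V, hV, rfl⟩ := hXY
    by_cases hX0 : X = 0
    · refine ⟨V, hV, fun hV0 => hXY0 (by simp [hX0, hV0]), ?_⟩
      have := hI.mul_mem_left (1, 0) _ (hI.star_mem _ hXYI)
      simpa [exchangeInvolution] using this
    · refine ⟨X, hX, hX0, ?_⟩
      have := hI.mul_mem_left (1, 0) _ hXYI
      simpa using this
  have htop := eq_top_of_homogeneous_mem hZ hZ0
    (I := I.comap (LinearMap.inl F _ (Matrix ι ι (AddMonoidAlgebra F H))ᵐᵒᵖ))
    (fun a x hx => by
      have := hI.mul_mem_left (a, 0) _ hx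
      simpa using this)
    (fun a x hx => by
      have := hI.mul_mem_right (a, 0) _ hx
      simpa using this) hZI
  intro W
  exact (htop ▸ Submodule.mem_top : W ∈ I.comap (LinearMap.inl F _ _))

end Models

/-! ### The sesquilinear form of the involution -/

section Form

variable {F G C : Type*} [Field F] [AddCommGroup G] [DecidableEq G] [Fintype G]
  [NonUnitalRing C] [Module F C] [IsScalarTower F C C] [SMulCommClass F C C]
  {𝒞 : G → Submodule F C} {s : C →ₗ[F] C} {e : C} {H : AddSubgroup G} {u : H → C}

/-- `p` is an isomorphism between the idempotents `e` and `e^*`, with inverse `p'`. The form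
`p' x^* y` on `C e` is hermitian up to the sign `ε`, with respect to the involution
`u ξ ↦ χ ξ • u ξ` of the corner. -/
structure IsStarLink (𝒞 : G → Submodule F C) (s : C →ₗ[F] C) (e : C) (u : H → C) (p p' : C)
    (c : G) (ε : F) (χ : H → F) : Prop where
  mem : p ∈ 𝒞 c
  inv_mem : p' ∈ 𝒞 (-c)
  mul_idem : p * e = p
  idem_mul_inv : e * p' = p'
  inv_mul_star : p' * s e = p'
  inv_mul : p' * p = e
  mul_inv : p * p' = s e
  star : s p = ε • p
  sign_sq : ε * ε = 1
  star_corner : ∀ ξ, s (u ξ) * p = χ ξ • (p * u ξ)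
  char_sq : ∀ ξ, χ ξ * χ ξ = 1
  char_zero : χ 0 = 1
  char_add : ∀ ξ ζ, χ (ξ + ζ) = χ ξ * χ ζ

/-- All scalars come from one-dimensionality of the corner components: p'p* lies in degree 0 and
gives ε, and p'(u_ξ)*p lies in degree ξ and gives χ(ξ). Applying * twice shows that both square to
1. -/
theorem IsGradedPrimitive.exists_isStarLink [IsAlgClosed F] [FiniteDimensional F C]
    (he : IsGradedPrimitive 𝒞 e) (h : IsAlgGrading 𝒞) (hs : IsGradedInvolution 𝒞 s)
    (hu : IsCornerBasis 𝒞 e u) {p : C} {c : G} (hp : p ∈ 𝒞 c) (hsp : s e * p = p)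
    (hpe : p * e = p) (hp0 : p ≠ 0) :
    ∃ (p' : C) (ε : F) (χ : H → F), IsStarLink 𝒞 s e u p p' c ε χ := by
  have hss : s e * s e = s e := by rw [← hs.map_mul, he.idem]
  have hse : s e ∈ 𝒞 0 := hs.map_mem _ _ he.mem
  obtain ⟨q, hq, hqp, heq⟩ := he.exists_left_inv_corner h hp hpe hp0
  obtain ⟨p', hp', hp'p, hep', hp's⟩ : ∃ p' ∈ 𝒞 (-c), p' * p = e ∧ e * p' = p' ∧ p' * s e = p' :=
    ⟨q * s e, by simpa using h.mul_mem _ _ _ hq _ hse, by rw [mul_assoc, hsp, hqp],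
      by rw [← mul_assoc, heq], by rw [mul_assoc, hss]⟩
  -- The image of pp' - e* under * lies in the degree 0 part of the corner, so pp' - e* = r e*.
  -- Multiplying by p on the right gives r p = 0.
  have hpp' : p * p' = s e := by
    obtain ⟨r, hr⟩ := he.eq_smul_of_mem_zero h (x := s (p * p' - s e))
      (hs.map_mem _ _ (sub_mem (by simpa using h.mul_mem _ _ _ hp _ hp') hse))
      (by rw [← hs.involutive e, ← hs.map_mul, hs.involutive e, sub_mul, mul_assoc, hp's, hss])
      (by rw [← hs.involutive e, ← hs.map_mul, hs.involutive e, mul_sub, ← mul_assoc, hsp, hss])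
    have hr' : p * p' - s e = r • s e := by
      rw [← hs.involutive (p * p' - s e), hr, map_smul]
    have h0 : r • p = 0 := by
      have := congrArg (· * p) hr'
      simp only [sub_mul, smul_mul_assoc, mul_assoc, hp'p, hpe, hsp, sub_self] at this
      exact this.symm
    rw [← sub_eq_zero, hr', (smul_eq_zero.1 h0).resolve_right hp0, zero_smul]
  have hspe : s p * e = s p := by
    conv_lhs => rw [← hs.involutive e, ← hs.map_mul, hsp]
  have hsesp : s e * s p = s p := by rw [← hs.map_mul, hpe]
  obtain ⟨ε, hε⟩ := he.eq_smul_of_mem_zero h (x := p' * s p)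
    (by simpa using h.mul_mem _ _ _ hp' _ (hs.map_mem _ _ hp))
    (by rw [← mul_assoc, hep']) (by rw [mul_assoc, hspe])
  have hstar : s p = ε • p := by
    rw [← hsesp, ← hpp', mul_assoc, hε, mul_smul_comm, hpe]
  have hεε : ε * ε = 1 := by
    have : (ε * ε) • p = (1 : F) • p := by
      rw [one_smul, mul_smul, ← hstar, ← map_smul, ← hstar, hs.involutive]
    exact smul_left_injective F hp0 this
  have hpu0 : ∀ ξ, p * u ξ ≠ 0 := fun ξ => he.mul_ne_zero hp hpe hp0 (hu.idem_mul ξ)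
    (hu.ne_zero he.ne_zero ξ)
  have hcorner : ∀ ξ, ∃ r : F, s (u ξ) * p = r • (p * u ξ) := fun ξ => by
    obtain ⟨r, hr⟩ := he.eq_smul_of_mem h (hu.mem ξ) (hu.idem_mul ξ) (hu.mul_idem ξ)
      (hu.ne_zero he.ne_zero ξ) (y := p' * s (u ξ) * p)
      (by
        have := h.mul_mem _ _ _ (h.mul_mem _ _ _ hp' _ (hs.map_mem _ _ (hu.mem ξ))) _ hp
        rwa [add_right_comm, neg_add_cancel, zero_add] at this)
      (by rw [← mul_assoc, ← mul_assoc, hep']) (by rw [mul_assoc, hpe])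
    refine ⟨r, ?_⟩
    have h1 : s e * s (u ξ) = s (u ξ) := by rw [← hs.map_mul, hu.mul_idem]
    rw [← h1, ← hpp', mul_assoc p, mul_assoc p, hr, mul_smul_comm]
  choose χ hχ using hcorner
  refine ⟨p', ε, χ, hp, hp', hpe, hep', hp's, hp'p, hpp', hstar, hεε, hχ, fun ξ => ?_, ?_,
    fun ξ ζ => ?_⟩
  -- Two evaluations of (u_ξ* p)*: directly, and after replacing u_ξ* p by χ(ξ) p u_ξ.
  · have h1 : s (s (u ξ) * p) = ε • (p * u ξ) := by
      rw [hs.map_mul, hs.involutive, hstar, smul_mul_assoc]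
    have h2 : s (s (u ξ) * p) = (χ ξ * χ ξ) • ε • (p * u ξ) := by
      rw [hχ, map_smul, hs.map_mul, hstar, mul_smul_comm, hχ, smul_smul, smul_smul, smul_smul]
      congr 1
      ring
    have hne : ε • (p * u ξ) ≠ 0 := smul_ne_zero (left_ne_zero_of_mul_eq_one hεε) (hpu0 ξ)
    refine smul_left_injective F hne ?_
    simp only [one_smul]
    rw [← h2, h1]
  · refine smul_left_injective F hp0 ?_
    have := hχ 0
    rw [hu.zero, hsp, hpe] at this
    simp only [one_smul]
    exact this.symm
  -- The involution reverses the product u_ξ u_ζ; commutativity of H restores the order.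
  · refine smul_left_injective F (hpu0 (ξ + ζ)) ?_
    simp only
    rw [← hχ, add_comm, ← hu.mul, hs.map_mul, mul_assoc, hχ, mul_smul_comm, ← mul_assoc, hχ,
      smul_mul_assoc, smul_smul, mul_assoc, hu.mul, hu.mul, add_comm ζ ξ]
    congr 1
    ring

namespace IsStarLink

variable {p p' : C} {c : G} {ε : F} {χ : H → F}

theorem star_inv (l : IsStarLink 𝒞 s e u p p' c ε χ) (hs : IsGradedInvolution 𝒞 s) :
    s p' = ε • p' := by
  have h1 : s p * s p' = s e := by rw [← hs.map_mul, l.inv_mul]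
  have h2 : e * s p' = s p' := by
    conv_lhs => rw [← hs.involutive e, ← hs.map_mul, l.inv_mul_star]
  rw [l.star, smul_mul_assoc] at h1
  rw [← h2, ← l.inv_mul, mul_assoc]
  have : p * s p' = ε • s e := by rw [← h1, smul_smul, l.sign_sq, one_smul]
  rw [this, mul_smul_comm, l.inv_mul_star]

theorem star_mul_corner (l : IsStarLink 𝒞 s e u p p' c ε χ) (hs : IsGradedInvolution 𝒞 s)
    (ξ : H) : s (p * u ξ) = (ε * χ ξ) • (p * u ξ) := by
  rw [hs.map_mul, l.star, mul_smul_comm, l.star_corner, smul_smul]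

theorem mul_corner_ne_zero (l : IsStarLink 𝒞 s e u p p' c ε χ) (hu : IsCornerBasis 𝒞 e u)
    (he0 : e ≠ 0) (ξ : H) : p * u ξ ≠ 0 := fun H0 => hu.ne_zero he0 ξ (by
  rw [← hu.idem_mul ξ, ← l.inv_mul, mul_assoc, H0, mul_zero])

/-- The values of the form on homogeneous elements. -/
theorem exists_form_eq (l : IsStarLink 𝒞 s e u p p' c ε χ) (h : IsAlgGrading 𝒞)
    (hs : IsGradedInvolution 𝒞 s) (hu : IsCornerBasis 𝒞 e u) {a b : G} {x y : C}
    (hx : x ∈ 𝒞 a) (hy : y ∈ 𝒞 b) (hxe : x * e = x) (hye : y * e = y) (hxy : s x * y ≠ 0) :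
    ∃ (ξ : H) (r : F), r ≠ 0 ∧ s x * y = r • (p * u ξ) := by
  have h1 : s x * y = p * (p' * s x * y) := by
    rw [← mul_assoc, ← mul_assoc, l.mul_inv, ← hs.map_mul, hxe]
  obtain ⟨hg, r, hr⟩ := hu.span _ _ (h.mul_mem _ _ _ (h.mul_mem _ _ _ l.inv_mem _
    (hs.map_mem _ _ hx)) _ hy) (by rw [← mul_assoc, ← mul_assoc, l.idem_mul_inv])
    (by rw [mul_assoc, hye]) (fun H0 => hxy (by rw [h1, H0, mul_zero]))
  refine ⟨_, r, ?_, by rw [h1, hr, mul_smul_comm]⟩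
  rintro rfl
  exact hxy (by rw [h1, hr, zero_smul, mul_zero])

end IsStarLink

/-- A dual system whose second family is obtained from the first one by the involution. -/
structure IsStarSystem {J : Type*} [DecidableEq J] (𝒞 : G → Submodule F C) (s : C →ₗ[F] C)
    (e : C) (u : H → C) (p' : C) (t : J → G) (v w : J → C) (τ : J → J) (ξ : J → H) (β : J → F) :
    Prop extends IsDualSystem 𝒞 e t v w where
  invol : ∀ j, τ (τ j) = j
  sign_sq : ∀ j, β j * β j = 1
  right_eq : ∀ j, w j = β j • (u (-ξ j) * p' * s (v (τ j)))

/-! ### The involution in the matrix units of a star system. -/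

namespace IsStarSystem

variable {p p' : C} {c : G} {ε : F} {χ : H → F} {J : Type*} [DecidableEq J] {t : J → G}
  {v w : J → C} {τ : J → J} {ξ : J → H} {β : J → F}

theorem star_left (S : IsStarSystem 𝒞 s e u p' t v w τ ξ β) (hs : IsGradedInvolution 𝒞 s)
    (hu : IsCornerBasis 𝒞 e u) (l : IsStarLink 𝒞 s e u p p' c ε χ) (i : J) :
    s (v i) = β (τ i) • (p * u (ξ (τ i)) * w (τ i)) := by
  rw [S.right_eq, S.invol, mul_smul_comm, smul_smul, S.sign_sq, one_smul, ← mul_assoc, ← mul_assoc,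
    mul_assoc p, hu.mul_neg, l.mul_idem, l.mul_inv, ← hs.map_mul, S.left_mul]

/-- The star of w_j is a multiple of v_{τ j} p' (u_{-ξ_j})*, and that of v_i is a multiple of p
u_{ξ_{τ i}} w_{τ i}. Moving p to the left past the starred corner elements costs values of χ and
cancels against p'. Every factor of the resulting scalar squares to 1. -/
theorem star_unit (S : IsStarSystem 𝒞 s e u p' t v w τ ξ β) (hs : IsGradedInvolution 𝒞 s)
    (hu : IsCornerBasis 𝒞 e u) (l : IsStarLink 𝒞 s e u p p' c ε χ) (i j : J) (θ : H) :
    s (v i * u θ * w j) = (β j * β (τ i) * ε * χ (-ξ j) * χ θ) •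
      (v (τ j) * u (-ξ j + θ + ξ (τ i)) * w (τ i)) := by
  have h1 : s (w j) = (β j * ε) • (v (τ j) * p' * s (u (-ξ j))) := by
    rw [S.right_eq, map_smul, hs.map_mul, hs.map_mul, hs.involutive, l.star_inv hs, smul_mul_assoc,
      mul_smul_comm, smul_smul, mul_assoc]
  have h2 : s (u (-ξ j)) * (s (u θ) * p) = (χ (-ξ j) * χ θ) • (p * u (-ξ j + θ)) := by
    rw [l.star_corner, mul_smul_comm, ← mul_assoc, l.star_corner, smul_mul_assoc, smul_smul,
      mul_assoc, hu.mul, mul_comm]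
  have h3 : s (w j) * s (u θ) * p =
      (β j * ε * (χ (-ξ j) * χ θ)) • (v (τ j) * u (-ξ j + θ)) := by
    rw [h1, smul_mul_assoc, smul_mul_assoc, mul_assoc (v (τ j) * p'), mul_assoc (v (τ j) * p'),
      mul_assoc (s (u (-ξ j))), h2, mul_smul_comm, smul_smul, mul_assoc (v (τ j)), ← mul_assoc p', l.inv_mul,
      hu.idem_mul, ← mul_assoc]
  rw [hs.map_mul, hs.map_mul, S.star_left hs hu l i, ← mul_assoc, mul_smul_comm, ← mul_assoc,
    ← mul_assoc, h3, smul_mul_assoc, smul_mul_assoc, smul_smul, mul_assoc (v (τ j)), hu.mul]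
  congr 1
  ring

variable [Fintype J]

/-- An incomplete system has dual homogeneous elements `r`, `y` in its residual space, with degrees
in a given set of representatives of `G / H`. -/
theorem exists_residual_pair (S : IsStarSystem 𝒞 s e u p' t v w τ ξ β) (h : IsAlgGrading 𝒞)
    (hs : IsGradedInvolution 𝒞 s) (he : IsGradedPrimitive 𝒞 e) (hu : IsCornerBasis 𝒞 e u)
    (l : IsStarLink 𝒞 s e u p p' c ε χ) {T : Set G} (hT : ∀ g : G, ∃ a : H, g + (a : G) ∈ T)
    (hne : ¬ ∀ x, x * e = x → (∑ i, v i * w i) * x = x) :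
    ∃ a ∈ T, ∃ b ∈ T, ∃ r ∈ 𝒞 (-a), ∃ y ∈ 𝒞 (-b), ∃ ζ : H, r * e = r ∧ y * e = y ∧
      (∀ i, s (v i) * r = 0) ∧ (∀ i, s (v i) * y = 0) ∧ s r * y = p * u ζ := by
  obtain ⟨g, r, hr, hr0, hre, hwr⟩ := S.exists_residual h he hne
  obtain ⟨z, hz, hzr⟩ := he.exists_left_inv g r hr hre hr0
  have hvr : ∀ i, s (v i) * r = 0 := fun i => by
    rw [S.star_left hs hu l, smul_mul_assoc, mul_assoc, hwr, mul_zero, smul_zero]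
  set f := ∑ i, v i * w i with hf
  have hwf : ∀ i, w i * f = w i := fun i => by
    rw [hf, Finset.mul_sum, Finset.sum_eq_single i]
    · rw [← mul_assoc, S.pairing, if_pos rfl, S.mul_right]
    · intro j _ hj
      rw [← mul_assoc, S.pairing, if_neg hj.symm, zero_mul]
    · simp
  have hfr : s f * r = 0 := by
    rw [hf, map_sum, Finset.sum_mul]
    exact Finset.sum_eq_zero fun i _ => by rw [hs.map_mul, mul_assoc, hvr, mul_zero]
  -- Since zr = e, the vector z*p pairs with r to (zr)*p = p. Subtracting its image under f makes it
  -- orthogonal to the system and keeps the pairing, because f*r = 0.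
  set y := s z * p - f * (s z * p) with hy
  have hymem : y ∈ 𝒞 (-g + c) :=
    have h1 := h.mul_mem _ _ _ (hs.map_mem _ _ hz) _ l.mem
    sub_mem h1 (by simpa using h.mul_mem _ _ _ (S.sum_mem h) _ h1)
  have hye : y * e = y := by rw [hy, sub_mul, mul_assoc f, mul_assoc (s z), l.mul_idem]
  have hvy : ∀ i, s (v i) * y = 0 := fun i => by
    rw [S.star_left hs hu l, smul_mul_assoc, mul_assoc, hy, mul_sub, ← mul_assoc (w _) f, hwf,
      sub_self, mul_zero, smul_zero]
  have hyr : s y * r = ε • p := by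
    rw [hy, map_sub, sub_mul, hs.map_mul f, mul_assoc _ (s f), hfr, mul_zero, sub_zero, hs.map_mul,
      hs.involutive, mul_assoc, hzr, l.star, smul_mul_assoc, l.mul_idem]
  have hry : s r * y = p := by
    have := congrArg s hyr
    rw [hs.map_mul, hs.involutive, map_smul, l.star, smul_smul, l.sign_sq, one_smul] at this
    exact this
  -- Right multiplication by corner elements moves the degrees of r and y into -T. The factor χ(-a)
  -- below cancels the sign from moving (u_{-a})* past p.
  obtain ⟨a, ha⟩ := hT (-g)
  obtain ⟨b, hb⟩ := hT (-(-g + c))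
  refine ⟨_, ha, _, hb, r * u (-a), ?_, χ (-a) • (y * u (-b)), ?_, -a + -b, ?_, ?_, ?_, ?_, ?_⟩
  · have := h.mul_mem _ _ _ hr _ (hu.mem (-a))
    rwa [neg_add, neg_neg]
  · have := h.mul_mem _ _ _ hymem _ (hu.mem (-b))
    rw [neg_add, neg_neg (-g + c)]
    exact Submodule.smul_mem _ _ this
  · rw [mul_assoc, hu.mul_idem]
  · rw [smul_mul_assoc, mul_assoc, hu.mul_idem]
  · intro i
    rw [← mul_assoc, hvr, zero_mul]
  · intro i
    rw [mul_smul_comm, ← mul_assoc, hvy, zero_mul, smul_zero]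
  · rw [mul_smul_comm, hs.map_mul, ← mul_assoc, mul_assoc (s _), hry, l.star_corner, smul_mul_assoc,
      smul_smul, l.char_sq, one_smul, mul_assoc, hu.mul]

end IsStarSystem

end Form

/-! ### Orthogonal frames -/

section Frames

variable {F G C : Type*} [Field F] [AddCommGroup G] [DecidableEq G] [Fintype G]
  [NonUnitalRing C] [Module F C] [IsScalarTower F C C] [SMulCommClass F C C]
  {𝒞 : G → Submodule F C} {s : C →ₗ[F] C} {e : C} {H : AddSubgroup G} {u : H → C}
  {p p' : C} {c : G} {ε : F} {χ : H → F} {T : Set G}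
  {ι κ : Type*} [DecidableEq ι] [DecidableEq κ]

/-- `x` is a homogeneous element of `C e` with degree in `-T`. -/
def IsHomogIn (𝒞 : G → Submodule F C) (e : C) (T : Set G) (x : C) : Prop :=
  x * e = x ∧ ∃ a ∈ T, x ∈ 𝒞 (-a)

/-- A homogeneous family in `C e` consisting of orthogonal vectors `x i` and hyperbolic pairs
`y k`, `z k`. -/
structure IsStarFrame (𝒞 : G → Submodule F C) (s : C →ₗ[F] C) (e : C) (u : H → C) (p : C)
    (T : Set G) (x : ι → C) (y z : κ → C) (ξ : ι → H) (ζ : κ → H) : Prop where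
  left : ∀ i, IsHomogIn 𝒞 e T (x i)
  fst : ∀ k, IsHomogIn 𝒞 e T (y k)
  snd : ∀ k, IsHomogIn 𝒞 e T (z k)
  left_left : ∀ i j, s (x i) * x j = if i = j then p * u (ξ i) else 0
  fst_snd : ∀ k l, s (y k) * z l = if k = l then p * u (ζ k) else 0
  left_fst : ∀ i k, s (x i) * y k = 0
  left_snd : ∀ i k, s (x i) * z k = 0
  fst_fst : ∀ k l, s (y k) * y l = 0
  snd_snd : ∀ k l, s (z k) * z l = 0

/-- The degree of a value of the form on elements of degree `0`. -/
theorem IsStarLink.eq_zero_of_form_eq (l : IsStarLink 𝒞 s e u p p' 0 ε χ) (h : IsAlgGrading 𝒞)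
    (hs : IsGradedInvolution 𝒞 s) (he : IsGradedPrimitive 𝒞 e) (hu : IsCornerBasis 𝒞 e u) {q r : C}
    (hq : q ∈ 𝒞 0) (hr : r ∈ 𝒞 0) {η : H} (hqr : s q * r = p * u η) : η = 0 := by
  have h1 := h.mul_mem _ _ _ (hs.map_mem _ _ hq) _ hr
  have h2 := h.mul_mem _ _ _ l.mem _ (hu.mem η)
  rw [hqr, add_zero] at h1
  by_contra hη
  refine l.mul_corner_ne_zero hu he.ne_zero η ?_
  rw [← h.proj_of_mem h1]
  exact h.proj_of_mem_ne h2 (by simpa using hη)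

namespace IsStarFrame

variable {x : ι → C} {y z : κ → C} {ξ : ι → H} {ζ : κ → H}

/-- All vectors of a frame. -/
abbrev vec (x : ι → C) (y z : κ → C) : ι ⊕ (κ ⊕ κ) → C := Sum.elim x (Sum.elim y z)

/-- The index of the vector that is not orthogonal to a given vector of a frame. -/
abbrev dualIndex (ι κ : Type*) : ι ⊕ (κ ⊕ κ) → ι ⊕ (κ ⊕ κ) := Sum.map id Sum.swap

/-- The sign of a vector of a frame. -/
abbrev sign (ι : Type*) (ε : F) (χ : H → F) (ζ : κ → H) : ι ⊕ (κ ⊕ κ) → F :=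
  Sum.elim (fun _ => 1) (Sum.elim (fun k => ε * χ (ζ k)) (fun _ => 1))

theorem snd_fst (A : IsStarFrame 𝒞 s e u p T x y z ξ ζ) (hs : IsGradedInvolution 𝒞 s)
    (l : IsStarLink 𝒞 s e u p p' c ε χ) (k k' : κ) :
    s (z k) * y k' = if k = k' then (ε * χ (ζ k)) • (p * u (ζ k)) else 0 := by
  have := congrArg s (A.fst_snd k' k)
  rw [hs.map_mul, hs.involutive] at this
  rw [this]
  by_cases hk : k = k'
  · subst hk
    rw [if_pos rfl, if_pos rfl, l.star_mul_corner hs]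
  · rw [if_neg hk, if_neg (Ne.symm hk), map_zero]

theorem fst_left (A : IsStarFrame 𝒞 s e u p T x y z ξ ζ) (hs : IsGradedInvolution 𝒞 s)
    (k : κ) (i : ι) : s (y k) * x i = 0 := by
  have := congrArg s (A.left_fst i k)
  rwa [hs.map_mul, hs.involutive, map_zero] at this

theorem snd_left (A : IsStarFrame 𝒞 s e u p T x y z ξ ζ) (hs : IsGradedInvolution 𝒞 s)
    (k : κ) (i : ι) : s (z k) * x i = 0 := by
  have := congrArg s (A.left_snd i k)
  rwa [hs.map_mul, hs.involutive, map_zero] at this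

/-- The star system of a frame. -/
theorem exists_isStarSystem (A : IsStarFrame 𝒞 s e u p T x y z ξ ζ) (h : IsAlgGrading 𝒞)
    (hs : IsGradedInvolution 𝒞 s) (he : IsGradedPrimitive 𝒞 e) (hu : IsCornerBasis 𝒞 e u)
    (l : IsStarLink 𝒞 s e u p p' c ε χ) :
    ∃ (t : ι ⊕ (κ ⊕ κ) → G) (w : ι ⊕ (κ ⊕ κ) → C), (∀ j, t j ∈ T) ∧
      IsStarSystem 𝒞 s e u p' t (vec x y z) w (dualIndex ι κ) (Sum.elim ξ (Sum.elim ζ ζ))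
        (sign ι ε χ ζ) := by
  have hv : ∀ j, IsHomogIn 𝒞 e T (vec x y z j) := by
    rintro (i | k | k)
    · exact A.left i
    · exact A.fst k
    · exact A.snd k
  have hβ : ∀ j, sign ι ε χ ζ j * sign ι ε χ ζ j = 1 := by
    rintro (i | k | k)
    · simp
    · simp only [sign, Sum.elim_inr, Sum.elim_inl]
      rw [mul_mul_mul_comm, l.sign_sq, l.char_sq, one_mul]
    · simp
  set Ξ : ι ⊕ (κ ⊕ κ) → H := Sum.elim ξ (Sum.elim ζ ζ) with hΞ
  -- Each vector pairs nontrivially only with its dual partner. The sign of the reversed pairing of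
  -- a hyperbolic pair is what `sign` records.
  have hpair : ∀ i j, s (vec x y z (dualIndex ι κ i)) * vec x y z j =
      if i = j then sign ι ε χ ζ i • (p * u (Ξ i)) else 0 := by
    rintro (i | k | k) (j | k' | k')
    all_goals simp [A.left_left, A.fst_snd, A.snd_fst hs l, A.left_fst, A.left_snd, A.fst_fst,
      A.snd_snd, A.fst_left hs, A.snd_left hs, hΞ]
  choose hve t hT ht using hv
  set w : ι ⊕ (κ ⊕ κ) → C := fun j =>
    sign ι ε χ ζ j • (u (-Ξ j) * p' * s (vec x y z (dualIndex ι κ j))) with hw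
  have hpairing : ∀ i j, w i * vec x y z j = if i = j then e else 0 := fun i j => by
    rw [hw]
    simp only
    rw [smul_mul_assoc, mul_assoc, hpair]
    by_cases hij : i = j
    · rw [if_pos hij, if_pos hij, mul_smul_comm, smul_smul, hβ, one_smul, mul_assoc,
        ← mul_assoc p', l.inv_mul, hu.idem_mul, hu.neg_mul]
    · rw [if_neg hij, if_neg hij, mul_zero, smul_zero]
  refine ⟨t, w, hT, ⟨ht, fun j => ?_, hve, fun j => ?_, hpairing⟩, ?_, hβ, fun j => rfl⟩
  -- The degree of w_j comes out in terms of the dual vector. It must equal t_j, because w_j v_j = e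
  -- is a nonzero element of degree 0.
  · have hmem : w j ∈ 𝒞 (((-Ξ j : H) : G) + -c + -t (dualIndex ι κ j)) :=
      Submodule.smul_mem _ _ (h.mul_mem _ _ _ (h.mul_mem _ _ _ (hu.mem _) _ l.inv_mem) _
        (hs.map_mem _ _ (ht _)))
    have h1 := h.mul_mem _ _ _ hmem _ (ht j)
    rw [hpairing, if_pos rfl] at h1
    have h2 := h.proj_of_mem h1
    by_cases h0 : ((-Ξ j : H) : G) + -c + -t (dualIndex ι κ j) + -t j = 0
    · rwa [add_neg_eq_zero.1 h0] at hmem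
    · rw [h.proj_of_mem_ne he.mem (Ne.symm h0)] at h2
      exact absurd h2.symm he.ne_zero
  · rw [hw]
    simp only
    rw [mul_smul_comm, ← mul_assoc, ← mul_assoc, hu.idem_mul]
  · rintro (i | k | k) <;> rfl

/-- Adjoin an anisotropic vector. -/
theorem cons_left [IsAlgClosed F] (A : IsStarFrame 𝒞 s e u p T x y z ξ ζ) (h : IsAlgGrading 𝒞)
    (hs : IsGradedInvolution 𝒞 s) (hu : IsCornerBasis 𝒞 e u)
    (l : IsStarLink 𝒞 s e u p p' c ε χ) {r : C} (hr : IsHomogIn 𝒞 e T r)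
    (hv : ∀ j, s (vec x y z j) * r = 0) (hrr : s r * r ≠ 0) :
    ∃ (x' : Option ι → C) (ξ' : Option ι → H), IsStarFrame 𝒞 s e u p T x' y z ξ' ζ := by
  obtain ⟨hre, a, haT, ha⟩ := hr
  obtain ⟨η, d, hd, hform⟩ := l.exists_form_eq h hs hu ha ha hre hre hrr
  -- Rescaling r by m multiplies the form by m², so the value on m r becomes p u_η without a scalar.
  obtain ⟨m, hm⟩ := IsAlgClosed.exists_pow_nat_eq d⁻¹ (n := 2) two_pos
  have hmm : m * m * d = 1 := by rw [← sq, hm, inv_mul_cancel₀ hd]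
  have hrv : ∀ j, s r * vec x y z j = 0 := fun j => by
    have := congrArg s (hv j)
    rwa [hs.map_mul, hs.involutive, map_zero] at this
  refine ⟨fun i => i.elim (m • r) x, fun i => i.elim η ξ, ?_, A.fst, A.snd, ?_, A.fst_snd, ?_, ?_,
    A.fst_fst, A.snd_snd⟩
  · rintro (_ | i)
    · exact ⟨by rw [Option.elim_none, smul_mul_assoc, hre], a, haT, Submodule.smul_mem _ _ ha⟩
    · exact A.left i
  · rintro (_ | i) (_ | j)
    · simp only [Option.elim_none, map_smul, smul_mul_assoc, mul_smul_comm, hform, smul_smul,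
        if_true]
      rw [← mul_assoc, hmm, one_smul]
    · have := hrv (Sum.inl j)
      simp only [Sum.elim_inl] at this
      simp [smul_mul_assoc, this]
    · have := hv (Sum.inl i)
      simp only [Sum.elim_inl] at this
      simp [mul_smul_comm, this]
    · simpa using A.left_left i j
  · rintro (_ | i) k
    · have := hrv (Sum.inr (Sum.inl k))
      simp only [Sum.elim_inl, Sum.elim_inr] at this
      simp [smul_mul_assoc, this]
    · exact A.left_fst i k
  · rintro (_ | i) k
    · have := hrv (Sum.inr (Sum.inr k))
      simp only [Sum.elim_inr] at this
      simp [smul_mul_assoc, this]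
    · exact A.left_snd i k

/-- Adjoin a hyperbolic pair. -/
theorem cons_pair (A : IsStarFrame 𝒞 s e u p T x y z ξ ζ)
    (hs : IsGradedInvolution 𝒞 s) {q r : C} (hq : IsHomogIn 𝒞 e T q) (hr : IsHomogIn 𝒞 e T r)
    (hvq : ∀ j, s (vec x y z j) * q = 0) (hvr : ∀ j, s (vec x y z j) * r = 0) (hqq : s q * q = 0)
    (hrr : s r * r = 0) {η : H} (hqr : s q * r = p * u η) :
    ∃ (y' z' : Option κ → C) (ζ' : Option κ → H), IsStarFrame 𝒞 s e u p T x y' z' ξ ζ' := by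
  have hstar : ∀ a b : C, s a * b = 0 → s b * a = 0 := fun a b hab => by
    have := congrArg s hab
    rwa [hs.map_mul, hs.involutive, map_zero] at this
  refine ⟨fun k => k.elim q y, fun k => k.elim r z, fun k => k.elim η ζ, A.left, ?_, ?_,
    A.left_left, ?_, ?_, ?_, ?_, ?_⟩
  · rintro (_ | k)
    exacts [hq, A.fst k]
  · rintro (_ | k)
    exacts [hr, A.snd k]
  · rintro (_ | k) (_ | k')
    · simpa using hqr
    · simpa using hstar _ _ (hvq (Sum.inr (Sum.inr k')))
    · simpa using hvr (Sum.inr (Sum.inl k))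
    · simpa using A.fst_snd k k'
  · rintro i (_ | k)
    exacts [hvq (Sum.inl i), A.left_fst i k]
  · rintro i (_ | k)
    exacts [hvr (Sum.inl i), A.left_snd i k]
  · rintro (_ | k) (_ | k')
    exacts [hqq, hstar _ _ (hvq (Sum.inr (Sum.inl k'))), hvq (Sum.inr (Sum.inl k)), A.fst_fst k k']
  · rintro (_ | k) (_ | k')
    exacts [hrr, hstar _ _ (hvr (Sum.inr (Sum.inr k'))), hvr (Sum.inr (Sum.inr k)), A.snd_snd k k']

/-- A frame that is not complete can be enlarged. If the form is symmetric and lives in degree `0`,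
then an anisotropic vector can be adjoined. -/
theorem extend [IsAlgClosed F] [CharZero F] [Fintype ι] [Fintype κ]
    (A : IsStarFrame 𝒞 s e u p T x y z ξ ζ) (h : IsAlgGrading 𝒞)
    (hs : IsGradedInvolution 𝒞 s) (he : IsGradedPrimitive 𝒞 e) (hu : IsCornerBasis 𝒞 e u)
    (l : IsStarLink 𝒞 s e u p p' c ε χ) (hT : ∀ g : G, ∃ a : H, g + (a : G) ∈ T)
    {t : ι ⊕ (κ ⊕ κ) → G} {w : ι ⊕ (κ ⊕ κ) → C}
    (S : IsStarSystem 𝒞 s e u p' t (vec x y z) w (dualIndex ι κ) (Sum.elim ξ (Sum.elim ζ ζ))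
        (sign ι ε χ ζ))
    (hne : ¬ ∀ a, a * e = a → (∑ i, vec x y z i * w i) * a = a) :
    (∃ (x' : Option ι → C) (ξ' : Option ι → H), IsStarFrame 𝒞 s e u p T x' y z ξ' ζ) ∨
    ¬ (T = {0} ∧ c = 0 ∧ ε = 1) ∧
      ∃ (y' z' : Option κ → C) (ζ' : Option κ → H), IsStarFrame 𝒞 s e u p T x y' z' ξ ζ' := by
  obtain ⟨a, ha, b, hb, q, hq, r, hr, η, hqe, hre, hvq, hvr, hqr⟩ :=
    S.exists_residual_pair h hs he hu l hT hne
  by_cases hqq : s q * q = 0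
  swap
  · exact Or.inl (A.cons_left h hs hu l ⟨hqe, a, ha, hq⟩ hvq hqq)
  by_cases hrr : s r * r = 0
  swap
  · exact Or.inl (A.cons_left h hs hu l ⟨hre, b, hb, hr⟩ hvr hrr)
  by_cases hcase : T = {0} ∧ c = 0 ∧ ε = 1
  · left
    obtain ⟨rfl, rfl, rfl⟩ := hcase
    rw [Set.mem_singleton_iff] at ha hb
    subst ha hb
    rw [neg_zero] at hq hr
    have hη : η = 0 := l.eq_zero_of_form_eq h hs he hu hq hr hqr
    have hqr' : s q * r = p := by rw [hqr, hη, hu.zero, l.mul_idem]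
    have hrq : s r * q = p := by
      have := congrArg s hqr'
      rwa [hs.map_mul, hs.involutive, l.star, one_smul] at this
    -- Both q and r are isotropic and pair to p in either order, so q + r has form value 2p ≠ 0.
    refine A.cons_left h hs hu l (r := q + r)
      ⟨by rw [add_mul, hqe, hre], 0, rfl, by rw [neg_zero]; exact add_mem hq hr⟩
      (fun j => by rw [mul_add, hvq, hvr, add_zero]) ?_
    rw [map_add, add_mul, mul_add, mul_add, hqq, hrr, hqr', hrq, zero_add, add_zero, ← two_smul F]
    refine smul_ne_zero two_ne_zero ?_
    have := l.mul_corner_ne_zero hu he.ne_zero 0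
    rwa [hu.zero, l.mul_idem] at this
  · exact Or.inr ⟨hcase, A.cons_pair hs ⟨hqe, a, ha, hq⟩ ⟨hre, b, hb, hr⟩ hvq hvr hqq hrr hqr⟩

end IsStarFrame

/-- Complete frames exist. -/
theorem IsStarLink.exists_complete_frame [IsAlgClosed F] [CharZero F] [FiniteDimensional F C]
    (l : IsStarLink 𝒞 s e u p p' c ε χ) (h : IsAlgGrading 𝒞)
    (hs : IsGradedInvolution 𝒞 s) (he : IsGradedPrimitive 𝒞 e) (hu : IsCornerBasis 𝒞 e u)
    (hT : ∀ g : G, ∃ a : H, g + (a : G) ∈ T) :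
    ∃ (ι κ : Type) (_ : Fintype ι) (_ : Fintype κ) (_ : DecidableEq ι) (_ : DecidableEq κ)
      (x : ι → C) (y z : κ → C) (ξ : ι → H) (ζ : κ → H) (t : ι ⊕ (κ ⊕ κ) → G)
      (w : ι ⊕ (κ ⊕ κ) → C),
      IsStarFrame 𝒞 s e u p T x y z ξ ζ ∧ (T = {0} ∧ c = 0 ∧ ε = 1 → IsEmpty κ) ∧
      (∀ j, t j ∈ T) ∧
      IsStarSystem 𝒞 s e u p' t (IsStarFrame.vec x y z) w (IsStarFrame.dualIndex ι κ)
        (Sum.elim ξ (Sum.elim ζ ζ)) (IsStarFrame.sign ι ε χ ζ) ∧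
      ∀ a, a * e = a → (∑ i, IsStarFrame.vec x y z i * w i) * a = a := by
  -- The induction counts the vectors of a frame, which are linearly independent. It also carries
  -- the absence of hyperbolic pairs in the symmetric case of degree 0.
  refine exists_of_forall_extend
    (P := fun n => ∃ (ι κ : Type) (_ : Fintype ι) (_ : Fintype κ) (_ : DecidableEq ι)
      (_ : DecidableEq κ) (x : ι → C) (y z : κ → C) (ξ : ι → H) (ζ : κ → H),
      IsStarFrame 𝒞 s e u p T x y z ξ ζ ∧ (T = {0} ∧ c = 0 ∧ ε = 1 → IsEmpty κ) ∧
      Fintype.card (ι ⊕ (κ ⊕ κ)) = n) (Module.finrank F C) ?_ ?_ ?_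
  · refine ⟨Empty, Empty, inferInstance, inferInstance, inferInstance, inferInstance, Empty.elim,
      Empty.elim, Empty.elim, Empty.elim, Empty.elim, ?_, fun _ => inferInstance, rfl⟩
    constructor <;> rintro ⟨⟩
  · rintro n ⟨ι, κ, _, _, _, _, x, y, z, ξ, ζ, A, -, rfl⟩
    obtain ⟨t, w, -, S⟩ := A.exists_isStarSystem h hs he hu l
    exact S.card_le he.ne_zero
  · rintro n ⟨ι, κ, _, _, _, _, x, y, z, ξ, ζ, A, hκ, rfl⟩
    obtain ⟨t, w, ht, S⟩ := A.exists_isStarSystem h hs he hu l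
    by_cases hc : ∀ a, a * e = a → (∑ i, IsStarFrame.vec x y z i * w i) * a = a
    · exact Or.inl ⟨ι, κ, _, _, _, _, x, y, z, ξ, ζ, t, w, A, hκ, ht, S, hc⟩
    · right
      rcases A.extend h hs he hu l hT S hc with ⟨x', ξ', A'⟩ | ⟨hcase, y', z', ζ', A'⟩
      · refine ⟨Fintype.card (Option ι ⊕ (κ ⊕ κ)), ?_, Option ι, κ, inferInstance, inferInstance,
          inferInstance, inferInstance, x', y, z, ξ', ζ, A', hκ, rfl⟩
        simp
      · refine ⟨Fintype.card (ι ⊕ (Option κ ⊕ Option κ)), ?_, ι, Option κ, inferInstance,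
          inferInstance, inferInstance, inferInstance, x, y', z', ξ, ζ', A', fun H => absurd H hcase, rfl⟩
        simp only [Fintype.card_sum, Fintype.card_option]
        omega

end Frames

/-! ### Transport of involutions -/

section Transport

variable {F G : Type*} [Field F]

theorem GradedStarIsomorphic.trans {A B D : Type*} [NonUnitalRing A] [Module F A]
    [NonUnitalRing B] [Module F B] [NonUnitalRing D] [Module F D] {𝒜 : G → Submodule F A}
    {σ : A →ₗ[F] A} {ℬ : G → Submodule F B} {τ : B →ₗ[F] B} {𝒟 : G → Submodule F D}
    {ρ : D →ₗ[F] D} (h1 : GradedStarIsomorphic 𝒜 σ ℬ τ) (h2 : GradedStarIsomorphic ℬ τ 𝒟 ρ) :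
    GradedStarIsomorphic 𝒜 σ 𝒟 ρ := by
  obtain ⟨φ, hφ, hφs, hφg⟩ := h1
  obtain ⟨ψ, hψ, hψs, hψg⟩ := h2
  refine ⟨φ.trans ψ, fun a b => by simp [hφ, hψ], fun a => by simp [hφs, hψs], fun g => ?_⟩
  rw [← hψg, ← hφg, LinearEquiv.coe_trans, Submodule.map_comp]

variable {A B : Type*} [NonUnitalRing A] [Module F A] [NonUnitalRing B] [Module F B]
  {𝒜 : G → Submodule F A} {σ : A →ₗ[F] A} {ℬ : G → Submodule F B}

/-- The involution of `B` induced by an isomorphism from `A`. -/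
def conjInvolution (φ : A ≃ₗ[F] B) (σ : A →ₗ[F] A) : B →ₗ[F] B :=
  φ.toLinearMap ∘ₗ σ ∘ₗ φ.symm.toLinearMap

theorem conjInvolution_apply (φ : A ≃ₗ[F] B) (σ : A →ₗ[F] A) (a : A) :
    conjInvolution φ σ (φ a) = φ (σ a) := by
  simp [conjInvolution]

theorem IsGradedInvolution.conj (hσ : IsGradedInvolution 𝒜 σ) (φ : A ≃ₗ[F] B)
    (hφ : ∀ a b, φ (a * b) = φ a * φ b) (hg : ∀ g, (𝒜 g).map (φ : A →ₗ[F] B) = ℬ g) :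
    IsGradedInvolution ℬ (conjInvolution φ σ) where
  involutive b := by
    obtain ⟨a, rfl⟩ := φ.surjective b
    rw [conjInvolution_apply, conjInvolution_apply, hσ.involutive]
  map_mul b b' := by
    obtain ⟨a, rfl⟩ := φ.surjective b
    obtain ⟨a', rfl⟩ := φ.surjective b'
    rw [← hφ, conjInvolution_apply, conjInvolution_apply, conjInvolution_apply, hσ.map_mul, hφ]
  map_mem g b hb := by
    rw [← hg] at hb ⊢
    obtain ⟨a, ha, rfl⟩ := hb
    exact ⟨σ a, hσ.map_mem g a ha, (conjInvolution_apply φ σ a).symm⟩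

theorem gradedStarIsomorphic_conj (φ : A ≃ₗ[F] B) (σ : A →ₗ[F] A)
    (hφ : ∀ a b, φ (a * b) = φ a * φ b) (hg : ∀ g, (𝒜 g).map (φ : A →ₗ[F] B) = ℬ g) :
    GradedStarIsomorphic 𝒜 σ ℬ (conjInvolution φ σ) :=
  ⟨φ, hφ, fun a => (conjInvolution_apply φ σ a).symm, hg⟩

end Transport

/-! ### The trivial group algebra -/

section TrivialSubgroup

variable {F G : Type*} [Field F] [AddCommGroup G]

/-- `M_ι(F[0])` is `M_ι(F)`. -/
theorem exists_elementary_of_bot {ι : Type*} [Fintype ι] [DecidableEq ι] (t : ι → G)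
    {σ : Matrix ι ι (AddMonoidAlgebra F (⊥ : AddSubgroup G)) →ₗ[F]
      Matrix ι ι (AddMonoidAlgebra F (⊥ : AddSubgroup G))}
    (hσ : IsGradedInvolution (groupMatrixGrading F ⊥ t) σ) (hel : IsElementaryOnGroupMatrix σ) :
    ∃ τ : Matrix ι ι F →ₗ[F] Matrix ι ι F, IsGradedInvolution (elementaryGrading F t) τ ∧
      IsElementaryOnMatrix τ ∧
      GradedStarIsomorphic (groupMatrixGrading F ⊥ t) σ (elementaryGrading F t) τ := by
  let ψ : Matrix ι ι (AddMonoidAlgebra F (⊥ : AddSubgroup G)) ≃ₐ[F] Matrix ι ι F :=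
    (AddMonoidAlgebra.uniqueAlgEquiv F (⊥ : AddSubgroup G) (A := F)).mapMatrix
  have hψ : ∀ i j ξ, ψ (homogMatrix (Matrix.single i j 1) ξ) = Matrix.single i j 1 := by
    intro i j ξ
    obtain rfl := Subsingleton.elim ξ 0
    ext a b
    by_cases hab : i = a ∧ j = b
    · obtain ⟨rfl, rfl⟩ := hab
      simp [ψ, homogMatrix, AddMonoidAlgebra.uniqueAlgEquiv, AddMonoidAlgebra.uniqueRingEquiv]
    · simp [ψ, homogMatrix, Matrix.single_apply_of_ne (h := hab)]
  have hg : ∀ g, (groupMatrixGrading F ⊥ t g).map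
      (ψ.toLinearEquiv : Matrix ι ι (AddMonoidAlgebra F (⊥ : AddSubgroup G)) →ₗ[F] _) =
      elementaryGrading F t g := by
    intro g
    rw [groupMatrixGrading, Submodule.map_span, elementaryGrading]
    congr 1
    ext X
    constructor
    · rintro ⟨_, ⟨i, j, ξ, hξ, rfl⟩, rfl⟩
      refine ⟨i, j, ?_, hψ i j ξ⟩
      obtain rfl := Subsingleton.elim ξ 0
      simpa using hξ
    · rintro ⟨i, j, hij, rfl⟩
      exact ⟨_, ⟨i, j, 0, by simpa using hij, rfl⟩, hψ i j 0⟩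
  have hmul : ∀ a b, ψ.toLinearEquiv (a * b) = ψ.toLinearEquiv a * ψ.toLinearEquiv b := map_mul ψ
  refine ⟨conjInvolution ψ.toLinearEquiv σ, hσ.conj _ hmul hg, fun i j => ?_,
    gradedStarIsomorphic_conj _ σ hmul hg⟩
  obtain ⟨i', j', ξ', α, hα, h⟩ := hel i j 0
  refine ⟨i', j', α, hα, ?_⟩
  have h1 := conjInvolution_apply ψ.toLinearEquiv σ (homogMatrix (Matrix.single i j 1) 0)
  rw [h, map_smul] at h1
  simpa only [AlgEquiv.toLinearEquiv_apply, hψ] using h1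

end TrivialSubgroup

/-! ### Involutions on `M_ι(F[H])` given by an involution of `M_ι(F)` -/

section Induced

variable {F G : Type*} [Field F] [AddCommGroup G] {H : AddSubgroup G}
  {ι : Type*}

/-- `X ↦ X η_ξ` as a linear map. -/
noncomputable def homogMatrixLinear (F : Type*) [Field F] (ι : Type*) (ξ : H) :
    Matrix ι ι F →ₗ[F] Matrix ι ι (AddMonoidAlgebra F H) :=
  (AddMonoidAlgebra.lsingle ξ : F →ₗ[F] AddMonoidAlgebra F H).mapMatrix

theorem homogMatrixLinear_apply (ξ : H) (X : Matrix ι ι F) :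
    homogMatrixLinear F ι ξ X = homogMatrix X ξ := rfl

theorem isInducedBy_of_single [Fintype ι] [DecidableEq ι]
    {σ : Matrix ι ι (AddMonoidAlgebra F H) →ₗ[F] Matrix ι ι (AddMonoidAlgebra F H)}
    {τ : Matrix ι ι F →ₗ[F] Matrix ι ι F} {χ : H → F}
    (h : ∀ i j ξ, σ (homogMatrix (Matrix.single i j 1) ξ) =
      χ ξ • homogMatrix (τ (Matrix.single i j 1)) ξ) : IsInducedBy σ τ χ := by
  intro X ξ
  have key : σ ∘ₗ homogMatrixLinear F ι ξ = χ ξ • (homogMatrixLinear F ι ξ ∘ₗ τ) := by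
    apply Matrix.ext_linearMap F
    intro i j
    ext1
    simpa [homogMatrixLinear_apply] using h i j ξ
  exact LinearMap.congr_fun key X

/-- The symplectic involution as a linear map. -/
noncomputable def symplecticLinear (F : Type*) [Field F] (m : ℕ) :
    Matrix (Fin m ⊕ Fin m) (Fin m ⊕ Fin m) F →ₗ[F] Matrix (Fin m ⊕ Fin m) (Fin m ⊕ Fin m) F where
  toFun := symplecticInvolution F m
  map_add' X Y := by simp [symplecticInvolution, Matrix.mul_add, Matrix.add_mul]
  map_smul' r X := by simp [symplecticInvolution]

theorem Matrix.mul_single_mul_apply {n : Type*} [Fintype n] [DecidableEq n] (A B : Matrix n n F)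
    (i j a b : n) : (A * Matrix.single i j (1 : F) * B : Matrix n n F) a b = A a i * B j b := by
  rw [Matrix.single_eq_single_vecMulVec_single, Matrix.mul_vecMulVec, Matrix.vecMulVec_mul,
    Matrix.mulVec_single_one, Matrix.single_one_vecMul, Matrix.vecMulVec_apply]
  rfl

/-- J exchanges the two halves of the index set with a sign. This is the pattern of a frame of
hyperbolic pairs with ε = -1. -/
theorem symplecticInvolution_single (m : ℕ) (i j : Fin m ⊕ Fin m) :
    symplecticInvolution F m (Matrix.single i j 1) =
      (Sum.elim (fun _ => -1) (fun _ => 1) i * Sum.elim (fun _ => -1) (fun _ => 1) j : F) •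
        Matrix.single j.swap i.swap 1 := by
  ext a b
  rw [symplecticInvolution, Matrix.J_inv, Matrix.transpose_single, Matrix.mul_single_mul_apply]
  rcases i with i | i <;> rcases j with j | j <;> rcases a with a | a <;> rcases b with b | b <;>
    by_cases h1 : i = b <;> by_cases h2 : j = a <;>
    simp [Matrix.J, Matrix.single_apply, Matrix.one_apply, h1, h2, eq_comm (b := i),
      eq_comm (b := j)]

end Induced

/-! ### The graded simple case -/

section GradedSimple

variable {F G C : Type*} [Field F] [AddCommGroup G] [DecidableEq G] [Fintype G]
  [NonUnitalRing C] [Module F C] [IsScalarTower F C C] [SMulCommClass F C C]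
  {𝒞 : G → Submodule F C} {s : C →ₗ[F] C} {e : C} {H : AddSubgroup G} {u : H → C}
  {p p' : C} {c : G} {ε : F} {χ : H → F} {T : Set G}

/-- The factorization e* = p e p' puts Ce*C inside CeC. -/
theorem IsStarLink.sandwich_eq_top (l : IsStarLink 𝒞 s e u p p' c ε χ)
    (hC : IsStarGradedSimple 𝒞 s) (h : IsAlgGrading 𝒞) (hs : IsGradedInvolution 𝒞 s)
    (he : IsGradedPrimitive 𝒞 e) : sandwich F e = ⊤ := by
  rw [← sandwich_sup_star_eq_top hC h hs he, left_eq_sup, sandwich, Submodule.span_le]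
  rintro _ ⟨a, b, rfl⟩
  have : a * s e * b = a * p * e * (p' * b) := by
    rw [← l.mul_inv, mul_assoc (a * p), ← mul_assoc e, l.idem_mul_inv]
    simp only [mul_assoc]
  rw [this]
  exact mul_mul_mem_sandwich _ _ _

/-- Transport of the involution to the matrix algebra of a complete dual system. -/
theorem IsDualSystem.exists_involution {K : Type*} [Fintype K] [DecidableEq K] {t : K → G}
    {v w : K → C} (D : IsDualSystem 𝒞 e t v w) (hu : IsCornerBasis 𝒞 e u)
    (h : IsAlgGrading 𝒞) (hs : IsGradedInvolution 𝒞 s) (he : IsGradedPrimitive 𝒞 e)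
    (hsp : IsGradedSemiprime 𝒞) (htop : sandwich F e = ⊤)
    (hl : ∀ x, x * e = x → (∑ i, v i * w i) * x = x) :
    Nonempty K ∧ ∃ σ : Matrix K K (AddMonoidAlgebra F H) →ₗ[F] Matrix K K (AddMonoidAlgebra F H),
      IsGradedInvolution (groupMatrixGrading F H t) σ ∧
      GradedStarIsomorphic 𝒞 s (groupMatrixGrading F H t) σ ∧
      ∀ i j θ i' j' θ' (α : F), s (v i * u θ * w j) = α • (v i' * u θ' * w j') →
        σ (homogMatrix (Matrix.single i j 1) θ) =
          α • homogMatrix (Matrix.single i' j' 1) θ' := by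
  obtain ⟨φ, hmul, hg, hφ⟩ := D.exists_linearEquiv hu h he.ne_zero
    (fun x => IsDualSystem.sum_mul_of_mem_sandwich he hl (htop ▸ Submodule.mem_top))
    (fun x => D.mul_sum_of_mem_sandwich h he hsp hl (htop ▸ Submodule.mem_top))
  refine ⟨?_, conjInvolution φ s, hs.conj φ hmul hg, gradedStarIsomorphic_conj φ s hmul hg, ?_⟩
  · by_contra hK
    rw [not_nonempty_iff] at hK
    have := hl e he.idem
    rw [Finset.univ_eq_empty, Finset.sum_empty, zero_mul] at this
    exact he.ne_zero this.symm
  · intro i j θ i' j' θ' α hα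
    rw [← hφ, conjInvolution_apply, hα, map_smul, hφ]

/-- A graded simple algebra with involution is a matrix algebra with an elementary involution. -/
theorem IsStarLink.exists_elementary [IsAlgClosed F] [CharZero F] [FiniteDimensional F C]
    (l : IsStarLink 𝒞 s e u p p' c ε χ) (hC : IsStarGradedSimple 𝒞 s) (h : IsAlgGrading 𝒞)
    (hs : IsGradedInvolution 𝒞 s) (he : IsGradedPrimitive 𝒞 e) (hu : IsCornerBasis 𝒞 e u)
    (hT : ∀ g : G, ∃ a : H, g + (a : G) ∈ T) :
    ∃ (k : ℕ) (t : Fin k → G) (σ : Matrix (Fin k) (Fin k) (AddMonoidAlgebra F H) →ₗ[F]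
      Matrix (Fin k) (Fin k) (AddMonoidAlgebra F H)), 1 ≤ k ∧ (∀ i, t i ∈ T) ∧
      IsGradedInvolution (groupMatrixGrading F H t) σ ∧ IsElementaryOnGroupMatrix σ ∧
      GradedStarIsomorphic 𝒞 s (groupMatrixGrading F H t) σ := by
  obtain ⟨ι, κ, _, _, _, _, x, y, z, ξ, ζ, t, w, A, -, ht, S, hl⟩ :=
    l.exists_complete_frame h hs he hu hT
  let f := (Fintype.equivFin (ι ⊕ (κ ⊕ κ))).symm
  obtain ⟨hk, σ, hσ, hiso, hσe⟩ := (S.comp f).exists_involution hu h hs he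
    (hC.isGradedSemiprime h hs) (l.sandwich_eq_top hC h hs he) (fun a ha => by
      simp only [Function.comp_apply]
      rw [Equiv.sum_comp f (fun i => IsStarFrame.vec x y z i * w i), hl a ha])
  refine ⟨_, _, σ, Fin.pos_iff_nonempty.2 hk, fun i => ht _, hσ, fun i j θ => ?_, hiso⟩
  have key := hσe i j θ (f.symm (IsStarFrame.dualIndex ι κ (f j)))
    (f.symm (IsStarFrame.dualIndex ι κ (f i))) _ _ (by
      simp only [Function.comp_apply, Equiv.apply_symm_apply]
      exact S.star_unit hs hu l (f i) (f j) θ)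
  refine ⟨_, _, _, _, ?_, key⟩
  -- The coefficient is a product of five factors of square 1, hence ±1.
  rw [← mul_self_eq_one_iff]
  have e1 := S.sign_sq (f j)
  have e2 := S.sign_sq (IsStarFrame.dualIndex ι κ (f i))
  have e3 := l.sign_sq
  have e4 := l.char_sq (-Sum.elim ξ (Sum.elim ζ ζ) (f j))
  have e5 := l.char_sq θ
  set b1 := IsStarFrame.sign ι ε χ ζ (f j)
  set b2 := IsStarFrame.sign ι ε χ ζ (IsStarFrame.dualIndex ι κ (f i))
  set b3 := χ (-Sum.elim ξ (Sum.elim ζ ζ) (f j))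
  calc b1 * b2 * ε * b3 * χ θ * (b1 * b2 * ε * b3 * χ θ)
      = (b1 * b1) * (b2 * b2) * (ε * ε) * (b3 * b3) * (χ θ * χ θ) := by ring
    _ = 1 := by rw [e1, e2, e3, e4, e5]; ring

/-- If the corner has elements of every degree, then a graded simple algebra with involution is a
matrix algebra with the natural grading and an induced involution. -/
theorem IsStarLink.exists_induced [IsAlgClosed F] [CharZero F] [FiniteDimensional F C]
    (l : IsStarLink 𝒞 s e u p p' 0 ε χ) (hC : IsStarGradedSimple 𝒞 s) (h : IsAlgGrading 𝒞)
    (hs : IsGradedInvolution 𝒞 s) (he : IsGradedPrimitive 𝒞 e) (hu : IsCornerBasis 𝒞 e u)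
    (hH : H = ⊤) :
    (∃ (k : ℕ) (σ : Matrix (Fin k) (Fin k) (AddMonoidAlgebra F H) →ₗ[F]
        Matrix (Fin k) (Fin k) (AddMonoidAlgebra F H)),
      1 ≤ k ∧ IsInducedBy σ Matrix.transpose χ ∧
      GradedStarIsomorphic 𝒞 s (groupMatrixGrading F H (0 : Fin k → G)) σ) ∨
    (∃ (m : ℕ) (σ : Matrix (Fin m ⊕ Fin m) (Fin m ⊕ Fin m) (AddMonoidAlgebra F H) →ₗ[F]
        Matrix (Fin m ⊕ Fin m) (Fin m ⊕ Fin m) (AddMonoidAlgebra F H)),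
      1 ≤ m ∧ IsInducedBy σ (symplecticInvolution F m) χ ∧
      GradedStarIsomorphic 𝒞 s (groupMatrixGrading F H (0 : Fin m ⊕ Fin m → G)) σ) := by
  -- With H = G all frame vectors can be taken of degree 0, which forces ξ and ζ to vanish below.
  have hT : ∀ g : G, ∃ a : H, g + (a : G) ∈ ({0} : Set G) := fun g =>
    ⟨⟨-g, hH ▸ AddSubgroup.mem_top _⟩, by simp⟩
  obtain ⟨ι, κ, _, _, _, _, x, y, z, ξ, ζ, t, w, A, hκ, ht, S, hl⟩ :=
    l.exists_complete_frame h hs he hu hT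
  have hhom : ∀ a, IsHomogIn 𝒞 e {0} a → a ∈ 𝒞 0 := by
    rintro a ⟨-, b, rfl, hb⟩
    rwa [neg_zero] at hb
  have hξ : ξ = 0 := funext fun i =>
    l.eq_zero_of_form_eq h hs he hu (hhom _ (A.left i)) (hhom _ (A.left i))
      ((A.left_left i i).trans (if_pos rfl))
  have hζ : ζ = 0 := funext fun k =>
    l.eq_zero_of_form_eq h hs he hu (hhom _ (A.fst k)) (hhom _ (A.snd k))
      ((A.fst_snd k k).trans (if_pos rfl))
  subst hξ hζ
  have hΞ : Sum.elim (0 : ι → H) (Sum.elim (0 : κ → H) (0 : κ → H)) = 0 := by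
    ext (i | k | k) <;> rfl
  rw [hΞ] at S
  have hstar : ∀ i j θ, s (IsStarFrame.vec x y z i * u θ * w j) =
      (IsStarFrame.sign ι ε χ 0 j * IsStarFrame.sign ι ε χ 0 (IsStarFrame.dualIndex ι κ i) * ε *
        χ θ) • (IsStarFrame.vec x y z (IsStarFrame.dualIndex ι κ j) * u θ *
          w (IsStarFrame.dualIndex ι κ i)) := fun i j θ => by
    have := S.star_unit hs hu l i j θ
    simpa only [Pi.zero_apply, neg_zero, zero_add, add_zero, l.char_zero, mul_one] using this
  have hinv : ∀ {K : Type} [Fintype K] [DecidableEq K] (f : K ≃ ι ⊕ (κ ⊕ κ)),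
      Nonempty K ∧ ∃ σ : Matrix K K (AddMonoidAlgebra F H) →ₗ[F] Matrix K K (AddMonoidAlgebra F H),
      GradedStarIsomorphic 𝒞 s (groupMatrixGrading F H (0 : K → G)) σ ∧
      ∀ (i j i' j' : K) (θ : H), f j' = IsStarFrame.dualIndex ι κ (f i) →
        f i' = IsStarFrame.dualIndex ι κ (f j) →
        σ (homogMatrix (Matrix.single i j 1) θ) = (IsStarFrame.sign ι ε χ 0 (f j) *
          IsStarFrame.sign ι ε χ 0 (f j') * ε * χ θ) •
          homogMatrix (Matrix.single i' j' 1) θ := by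
    intro K _ _ f
    have ht0 : t ∘ f = 0 := funext fun i => ht _
    have D := S.comp f
    rw [ht0] at D
    obtain ⟨hK, σ, -, hiso, hσ⟩ := D.exists_involution hu h hs he
      (hC.isGradedSemiprime h hs) (l.sandwich_eq_top hC h hs he) (fun a ha => by
        simp only [Function.comp_apply]
        rw [Equiv.sum_comp f (fun i => IsStarFrame.vec x y z i * w i), hl a ha])
    refine ⟨hK, σ, hiso, fun i j i' j' θ hj' hi' => hσ i j θ i' j' θ _ ?_⟩
    simp only [Function.comp_apply, hi', hj']
    exact hstar (f i) (f j) θ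
  rcases mul_self_eq_one_iff.1 l.sign_sq with rfl | rfl
  · left
    have := hκ ⟨rfl, rfl, rfl⟩
    let f : Fin (Fintype.card ι) ≃ ι ⊕ (κ ⊕ κ) :=
      (Fintype.equivFin ι).symm.trans (Equiv.sumEmpty ι (κ ⊕ κ)).symm
    obtain ⟨hk, σ, hiso, hσ⟩ := hinv f
    refine ⟨_, σ, Fin.pos_iff_nonempty.2 hk, ?_, hiso⟩
    refine isInducedBy_of_single (τ := (Matrix.transposeLinearEquiv (Fin _) (Fin _) F F).toLinearMap) fun i j θ => ?_
    rw [hσ i j j i θ rfl rfl]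
    simp [f, Matrix.transpose_single]
  · right
    -- An anisotropic vector would satisfy x*x = p. Applying * gives p = -p, impossible since 2p ≠
    -- 0.
    have : IsEmpty ι := ⟨fun i => by
      have h1 := A.left_left i i
      rw [if_pos rfl, Pi.zero_apply, hu.zero, l.mul_idem] at h1
      have h2 := congrArg s h1
      rw [hs.map_mul, hs.involutive, h1, l.star, neg_smul, one_smul] at h2
      have h3 := l.mul_corner_ne_zero hu he.ne_zero 0
      rw [hu.zero, l.mul_idem] at h3
      refine smul_ne_zero (two_ne_zero (α := F)) h3 ?_
      rw [two_smul]
      exact add_eq_zero_iff_eq_neg.2 h2⟩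
    -- The two halves index the first and second members of the hyperbolic pairs, so passing to the
    -- dual vector is `Sum.swap`.
    let f : Fin (Fintype.card κ) ⊕ Fin (Fintype.card κ) ≃ ι ⊕ (κ ⊕ κ) :=
      ((Fintype.equivFin κ).symm.sumCongr (Fintype.equivFin κ).symm).trans
        (Equiv.emptySum ι (κ ⊕ κ)).symm
    have hf : ∀ i, f i.swap = IsStarFrame.dualIndex ι κ (f i) := by
      rintro (i | i) <;> rfl
    obtain ⟨hk, σ, hiso, hσ⟩ := hinv f
    refine ⟨_, σ, ?_, ?_, hiso⟩
    · obtain ⟨i | i⟩ := hk <;> exact i.pos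
    · refine isInducedBy_of_single (τ := symplecticLinear F _) fun i j θ => ?_
      have hsymp : symplecticLinear F (Fintype.card κ) (Matrix.single i j 1) = _ :=
        symplecticInvolution_single _ i j
      rw [hσ i j j.swap i.swap θ (hf i) (hf j), hsymp, ← homogMatrixLinear_apply,
        ← homogMatrixLinear_apply, map_smul, smul_smul]
      congr 1
      rcases i with i | i <;> rcases j with j | j <;> simp [f, l.char_zero]

end GradedSimple

/-! ### Cyclic groups of prime order and of order four -/

section Cyclic

variable {F G : Type*} [Field F] [AddCommGroup G]

theorem exists_nsmul_eq_of_zmultiples_eq_top [Finite G] {g : G}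
    (hg : AddSubgroup.zmultiples g = ⊤) (x : G) : ∃ n : ℕ, n • g = x := by
  have : x ∈ AddSubgroup.zmultiples g := hg ▸ AddSubgroup.mem_top x
  rwa [← mem_multiples_iff_mem_zmultiples] at this

theorem addSubgroup_eq_of_card {q : ℕ} (hq : q.Prime ∨ q = 4) (hG : Nat.card G = q) {g : G}
    (hg : AddSubgroup.zmultiples g = ⊤) (H : AddSubgroup G) :
    H = ⊥ ∨ H = ⊤ ∨ (q = 4 ∧ H = AddSubgroup.zmultiples (2 • g)) := by
  rcases hq with hq | rfl
  · have : Fact (Nat.card G).Prime := ⟨hG ▸ hq⟩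
    rcases H.eq_bot_or_eq_top_of_prime_card with h | h
    · exact Or.inl h
    · exact Or.inr (Or.inl h)
  · have : Finite G := Nat.finite_of_card_ne_zero (by omega)
    have h4 : 4 • g = 0 := by rw [← hG]; exact card_nsmul_eq_zero'
    by_cases hgH : g ∈ H
    · right; left
      rw [← top_le_iff, ← hg]
      exact AddSubgroup.zmultiples_le_of_mem hgH
    -- In order four, 3g is a generator as well: 3(3g) = 9g = g.
    have h3 : 3 • g ∉ H := fun h3 => hgH (by
      have h9 := H.nsmul_mem h3 3
      have : 3 • 3 • g = g + (4 • g + 4 • g) := by abel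
      rwa [this, h4, add_zero, add_zero] at h9)
    have hodd : ∀ x ∈ H, x = 0 ∨ x = 2 • g := by
      intro x hx
      obtain ⟨n, rfl⟩ := exists_nsmul_eq_of_zmultiples_eq_top hg x
      have hmod : n • g = (n % 4) • g := by
        conv_lhs => rw [← Nat.mod_add_div n 4, add_nsmul, mul_nsmul, h4, smul_zero, add_zero]
      rw [hmod] at hx ⊢
      have hlt : n % 4 < 4 := Nat.mod_lt _ (by norm_num)
      generalize n % 4 = m at hx hlt
      interval_cases m
      · exact Or.inl (zero_nsmul g)
      · exact absurd (one_nsmul g ▸ hx) hgH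
      · exact Or.inr rfl
      · exact absurd hx h3
    by_cases h2 : 2 • g ∈ H
    · refine Or.inr (Or.inr ⟨rfl, le_antisymm (fun x hx => ?_)
        (AddSubgroup.zmultiples_le_of_mem h2)⟩)
      rcases hodd x hx with rfl | rfl
      · exact zero_mem _
      · exact AddSubgroup.mem_zmultiples _
    · left
      rw [AddSubgroup.eq_bot_iff_forall]
      exact fun x hx => (hodd x hx).resolve_right fun h => h2 (h ▸ hx)

theorem exists_add_mem_pair [Finite G] {g : G} (hg : AddSubgroup.zmultiples g = ⊤) (x : G) :
    ∃ a : AddSubgroup.zmultiples (2 • g), x + (a : G) ∈ ({0, g} : Set G) := by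
  obtain ⟨n, rfl⟩ := exists_nsmul_eq_of_zmultiples_eq_top hg x
  -- Subtracting the even part of n leaves (n mod 2) g.
  refine ⟨⟨-((n / 2) • 2 • g), neg_mem (nsmul_mem (AddSubgroup.mem_zmultiples _) _)⟩, ?_⟩
  have h1 : n • g + -((n / 2) • 2 • g) = (n % 2) • g := by
    conv_lhs => rw [← Nat.mod_add_div n 2, add_nsmul, mul_nsmul']
    rw [show (n % 2 + 2 * (n / 2)) / 2 = n / 2 by omega, smul_comm, add_neg_cancel_right]
  rw [h1]
  rcases Nat.mod_two_eq_zero_or_one n with h | h <;> rw [h] <;> simp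

/-- A character with values `±1` of a cyclic group of order `q` is trivial or the parity sign. -/
theorem sign_character_eq {q : ℕ} (hq : q.Prime ∨ q = 4) (hG : Nat.card G = q) {g : G}
    (hg : AddSubgroup.zmultiples g = ⊤) {χ : (⊤ : AddSubgroup G) → F} (h0 : χ 0 = 1)
    (hadd : ∀ ξ ζ, χ (ξ + ζ) = χ ξ * χ ζ) (hsq : ∀ ξ, χ ξ * χ ξ = 1) :
    (χ = fun _ => 1) ∨ ∃ (n : ℕ) (e : (⊤ : AddSubgroup G) ≃+ ZMod n), (n = 2 ∨ n = 4) ∧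
      χ = fun θ => (-1) ^ (e θ).val := by
  have hq0 : q ≠ 0 := by rcases hq with hq | rfl; exacts [hq.ne_zero, by norm_num]
  have : Finite G := Nat.finite_of_card_ne_zero (hG ▸ hq0)
  have : NeZero q := ⟨hq0⟩
  let γ : (⊤ : AddSubgroup G) := ⟨g, AddSubgroup.mem_top g⟩
  have hpow : ∀ n : ℕ, χ (n • γ) = χ γ ^ n := fun n => by
    induction n with
    | zero => rw [zero_nsmul, pow_zero, h0]
    | succ n ih => rw [succ_nsmul, hadd, ih, pow_succ]
  have hgen : ∀ ξ : (⊤ : AddSubgroup G), ∃ n : ℕ, n • γ = ξ := fun ξ => by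
    obtain ⟨n, hn⟩ := exists_nsmul_eq_of_zmultiples_eq_top hg (ξ : G)
    exact ⟨n, Subtype.ext hn⟩
  rcases mul_self_eq_one_iff.1 (hsq γ) with h1 | h1
  · left
    funext ξ
    obtain ⟨n, rfl⟩ := hgen ξ
    rw [hpow, h1, one_pow]
  · by_cases hchar : (-1 : F) = 1
    · left
      funext ξ
      obtain ⟨n, rfl⟩ := hgen ξ
      rw [hpow, h1, hchar, one_pow]
    right
    have hγ : q • γ = 0 := Subtype.ext (by
      change q • g = 0
      rw [← hG]; exact card_nsmul_eq_zero')
    -- For odd q, 1 = χ(qγ) = (-1)^q = -1, which is excluded here.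
    have hq2 : q = 2 ∨ q = 4 := by
      refine hq.imp_left fun hp => hp.eq_two_or_odd'.resolve_right fun hodd => hchar ?_
      rw [← hodd.neg_one_pow, ← h1, ← hpow, hγ, h0]
    have hcard : Nat.card (⊤ : AddSubgroup G) = q := by rw [AddSubgroup.card_top, hG]
    have hγgen : ∀ ξ : (⊤ : AddSubgroup G), ξ ∈ AddSubgroup.zmultiples γ := fun ξ => by
      obtain ⟨n, rfl⟩ := hgen ξ
      exact nsmul_mem (AddSubgroup.mem_zmultiples _) _
    refine ⟨q, (zmodAddEquivOfGenerator hγgen hcard).symm, hq2, ?_⟩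
    funext ξ
    have hξ : ((zmodAddEquivOfGenerator hγgen hcard).symm ξ).val • γ = ξ := by
      have := zmodAddEquivOfGenerator_apply_intCast hγgen hcard
        (((zmodAddEquivOfGenerator hγgen hcard).symm ξ).val : ℤ)
      rw [Int.cast_natCast, ZMod.natCast_zmod_val, AddEquiv.apply_symm_apply, natCast_zsmul] at this
      exact this.symm
    conv_lhs => rw [← hξ]
    rw [hpow, h1]

end Cyclic

/-! ### The classification -/

theorem IsGradedPrimitive.exists_homogeneous_link {F G C : Type*} [Field F] [AddCommGroup G]
    [DecidableEq G] [Fintype G] [NonUnitalRing C] [Module F C] {𝒞 : G → Submodule F C}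
    {s : C →ₗ[F] C} {e : C} (he : IsGradedPrimitive 𝒞 e) (h : IsAlgGrading 𝒞)
    (hs : IsGradedInvolution 𝒞 s) (h0 : ¬ ∀ c, s e * c * e = 0) :
    ∃ a, ∃ p ∈ 𝒞 a, s e * p = p ∧ p * e = p ∧ p ≠ 0 := by
  push Not at h0
  obtain ⟨c, hc⟩ := h0
  obtain ⟨g, hg⟩ : ∃ g, s e * h.proj g c * e ≠ 0 := by
    by_contra! H
    apply hc
    rw [← h.sum_proj c, Finset.mul_sum, Finset.sum_mul]
    exact Finset.sum_eq_zero fun i _ => H i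
  refine ⟨_, _, h.mul_mem _ _ _ (h.mul_mem _ _ _ (hs.map_mem _ _ he.mem) _ (h.proj_mem g c)) _
    he.mem, ?_, ?_, hg⟩
  · rw [← mul_assoc, ← mul_assoc, ← hs.map_mul, he.idem]
  · rw [mul_assoc, he.idem]

theorem mainTheorem4 {F G C : Type*} [Field F] [IsAlgClosed F] [CharZero F]
    [AddCommGroup G] [DecidableEq G] (q : ℕ) (hq : q.Prime ∨ q = 4) (hG : Nat.card G = q)
    (g : G) (hg : AddSubgroup.zmultiples g = ⊤)
    [NonUnitalRing C] [Module F C] [IsScalarTower F C C] [SMulCommClass F C C]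
    [FiniteDimensional F C]
    (𝒞 : G → Submodule F C) (h𝒞 : IsAlgGrading 𝒞)
    (s : C →ₗ[F] C) (hs : IsGradedInvolution 𝒞 s) :
    IsStarGradedSimple 𝒞 s ↔
      -- 1: `B × Bᵒᵖ` with the exchange involution, where `B = M_k(F[H])` is graded simple
      (∃ (H : AddSubgroup G) (k : ℕ) (t : Fin k → G),
        (H = ⊥ ∨ H = ⊤ ∨ (q = 4 ∧ H = AddSubgroup.zmultiples (2 • g))) ∧ 1 ≤ k ∧
        GradedStarIsomorphic 𝒞 s (prodOpGrading (groupMatrixGrading F H t))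
          (exchangeInvolution F (Matrix (Fin k) (Fin k) (AddMonoidAlgebra F H)))) ∨
      -- 2: `M_k(F)` with an elementary grading and an elementary involution
      (∃ (k : ℕ) (t : Fin k → G) (σ : Matrix (Fin k) (Fin k) F →ₗ[F] Matrix (Fin k) (Fin k) F),
        1 ≤ k ∧ IsGradedInvolution (elementaryGrading F t) σ ∧ IsElementaryOnMatrix σ ∧
        GradedStarIsomorphic 𝒞 s (elementaryGrading F t) σ) ∨
      -- 3: `M_k(F[H])`, natural grading, transpose or symplectic involution
      (∃ H : AddSubgroup G,
        (∃ (k : ℕ) (σ : Matrix (Fin k) (Fin k) (AddMonoidAlgebra F H) →ₗ[F]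
            Matrix (Fin k) (Fin k) (AddMonoidAlgebra F H)),
          1 ≤ k ∧ IsInducedBy σ Matrix.transpose (fun _ => 1) ∧
          GradedStarIsomorphic 𝒞 s (groupMatrixGrading F H (0 : Fin k → G)) σ) ∨
        (∃ (m : ℕ) (σ : Matrix (Fin m ⊕ Fin m) (Fin m ⊕ Fin m) (AddMonoidAlgebra F H) →ₗ[F]
            Matrix (Fin m ⊕ Fin m) (Fin m ⊕ Fin m) (AddMonoidAlgebra F H)),
          1 ≤ m ∧ IsInducedBy σ (symplecticInvolution F m) (fun _ => 1) ∧
          GradedStarIsomorphic 𝒞 s (groupMatrixGrading F H (0 : Fin m ⊕ Fin m → G)) σ)) ∨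
      -- 4: the same with the sign `(-1)^θ`, where `H` is isomorphic to `ℤ/2` or `ℤ/4`
      (∃ (H : AddSubgroup G) (n : ℕ) (e : H ≃+ ZMod n), (n = 2 ∨ n = 4) ∧
        ((∃ (k : ℕ) (σ : Matrix (Fin k) (Fin k) (AddMonoidAlgebra F H) →ₗ[F]
            Matrix (Fin k) (Fin k) (AddMonoidAlgebra F H)),
          1 ≤ k ∧ IsInducedBy σ Matrix.transpose (fun θ => (-1) ^ (e θ).val) ∧
          GradedStarIsomorphic 𝒞 s (groupMatrixGrading F H (0 : Fin k → G)) σ) ∨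
        (∃ (m : ℕ) (σ : Matrix (Fin m ⊕ Fin m) (Fin m ⊕ Fin m) (AddMonoidAlgebra F H) →ₗ[F]
            Matrix (Fin m ⊕ Fin m) (Fin m ⊕ Fin m) (AddMonoidAlgebra F H)),
          1 ≤ m ∧ IsInducedBy σ (symplecticInvolution F m) (fun θ => (-1) ^ (e θ).val) ∧
          GradedStarIsomorphic 𝒞 s (groupMatrixGrading F H (0 : Fin m ⊕ Fin m → G)) σ))) ∨
      -- 5: `q = 4`, `M_k(F[H])` with `H = {0, 2}`, a tuple in `{0, 1}^k`, an elementary involution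
      (q = 4 ∧ ∃ (k : ℕ) (t : Fin k → G)
          (σ : Matrix (Fin k) (Fin k) (AddMonoidAlgebra F (AddSubgroup.zmultiples (2 • g))) →ₗ[F]
            Matrix (Fin k) (Fin k) (AddMonoidAlgebra F (AddSubgroup.zmultiples (2 • g)))),
        1 ≤ k ∧ (∀ i, t i = 0 ∨ t i = g) ∧
        IsGradedInvolution (groupMatrixGrading F (AddSubgroup.zmultiples (2 • g)) t) σ ∧
        IsElementaryOnGroupMatrix σ ∧
        GradedStarIsomorphic 𝒞 s
          (groupMatrixGrading F (AddSubgroup.zmultiples (2 • g)) t) σ) := by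
  have hq0 : q ≠ 0 := by rcases hq with hq | rfl; exacts [hq.ne_zero, by norm_num]
  have : Finite G := Nat.finite_of_card_ne_zero (hG ▸ hq0)
  have : Fintype G := Fintype.ofFinite G
  constructor
  · intro hC
    have : IsAddCyclic G := ⟨g, fun x =>
      AddSubgroup.mem_zmultiples_iff.1 (hg ▸ AddSubgroup.mem_top x)⟩
    have hsp := hC.isGradedSemiprime h𝒞 hs
    obtain ⟨e, he⟩ := hC.exists_isGradedPrimitive h𝒞 hs
    obtain ⟨H, u, hu⟩ := he.exists_isCornerBasis h𝒞
    have hH := addSubgroup_eq_of_card hq hG hg H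
    -- If e*Ce = 0 the involution exchanges two ideals; otherwise e and e* are linked and the form
    -- is available.
    by_cases h0 : ∀ c, s e * c * e = 0
    · left
      obtain ⟨k, t, v, w, D, hl⟩ := he.exists_complete_isDualSystem h𝒞
      refine ⟨H, k, t, hH, Nat.one_le_iff_ne_zero.2 ?_,
        D.gradedStarIsomorphic_prodOp hC h𝒞 hs he hu hl h0⟩
      rintro rfl
      have := hl e he.idem
      rw [Finset.univ_eq_empty, Finset.sum_empty, zero_mul] at this
      exact he.ne_zero this.symm
    right
    obtain ⟨a, p, hp, hsep, hpe, hp0⟩ := he.exists_homogeneous_link h𝒞 hs h0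
    rcases hH with rfl | rfl | ⟨rfl, rfl⟩
    · left
      obtain ⟨p', ε, χ, l⟩ := he.exists_isStarLink h𝒞 hs hu hp hsep hpe hp0
      obtain ⟨k, t, σ, hk, -, hσ, hel, hiso⟩ := l.exists_elementary (T := Set.univ) hC h𝒞 hs he hu
        fun _ => ⟨0, trivial⟩
      obtain ⟨τ, hτ, hτe, hτi⟩ := exists_elementary_of_bot t hσ hel
      exact ⟨k, t, τ, hk, hτ, hτe, hiso.trans hτi⟩
    · right
      -- Since the corner has elements of every degree, p can be replaced by p u_{-a}, which has
      -- degree 0.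
      let ζ : (⊤ : AddSubgroup G) := ⟨-a, AddSubgroup.mem_top _⟩
      obtain ⟨p', ε, χ, l⟩ := he.exists_isStarLink h𝒞 hs hu (p := p * u ζ) (c := 0)
        (by simpa [ζ] using h𝒞.mul_mem _ _ _ hp _ (hu.mem ζ))
        (by rw [← mul_assoc, hsep]) (by rw [mul_assoc, hu.mul_idem])
        (he.mul_ne_zero hp hpe hp0 (hu.idem_mul ζ) (hu.ne_zero he.ne_zero ζ))
      have key := l.exists_induced hC h𝒞 hs he hu rfl
      -- In this direction items 3 and 4 arise only with H = G; smaller H are absorbed by items 2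
      -- and 5.
      rcases sign_character_eq hq hG hg l.char_zero l.char_add l.char_sq with rfl | ⟨n, E, hn, rfl⟩
      · exact Or.inl ⟨⊤, key⟩
      · exact Or.inr (Or.inl ⟨⊤, n, E, hn, key⟩)
    · right; right; right
      obtain ⟨p', ε, χ, l⟩ := he.exists_isStarLink h𝒞 hs hu hp hsep hpe hp0
      -- The set {0, g} represents the two cosets of the subgroup of order two, which yields a tuple
      -- with entries 0 and g.
      obtain ⟨k, t, σ, hk, ht, hσ, hel, hiso⟩ := l.exists_elementary (T := {0, g}) hC h𝒞 hs he hu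
        (exists_add_mem_pair hg)
      exact ⟨rfl, k, t, σ, hk, ht, hσ, hel, hiso⟩
  -- Only the exchange algebra needs its involution for simplicity; the other models have no proper
  -- nonzero graded ideals at all.
  · rintro (⟨H, k, t, -, hk, hiso⟩ | ⟨k, t, σ, hk, -, -, hiso⟩ |
      ⟨H, ⟨k, σ, hk, -, hiso⟩ | ⟨m, σ, hm, -, hiso⟩⟩ |
      ⟨H, n, E, -, ⟨k, σ, hk, -, hiso⟩ | ⟨m, σ, hm, -, hiso⟩⟩ |
      ⟨-, k, t, σ, hk, -, -, -, hiso⟩)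
    · have := Fin.pos_iff_nonempty.1 hk
      exact hiso.isStarGradedSimple (isStarGradedSimple_prodOp H t)
    · have := Fin.pos_iff_nonempty.1 hk
      exact hiso.isStarGradedSimple (isStarGradedSimple_matrix _ σ)
    · have := Fin.pos_iff_nonempty.1 hk
      exact hiso.isStarGradedSimple (isStarGradedSimple_groupMatrix H _ σ)
    · have := Fin.pos_iff_nonempty.1 hm
      exact hiso.isStarGradedSimple (isStarGradedSimple_groupMatrix H _ σ)
    · have := Fin.pos_iff_nonempty.1 hk
      exact hiso.isStarGradedSimple (isStarGradedSimple_groupMatrix H _ σ)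
    · have := Fin.pos_iff_nonempty.1 hm
      exact hiso.isStarGradedSimple (isStarGradedSimple_groupMatrix H _ σ)
    · have := Fin.pos_iff_nonempty.1 hk
      exact hiso.isStarGradedSimple (isStarGradedSimple_groupMatrix _ t σ)
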